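/- **Additive multislope ski rental.** An instance consists of $k+1$ slopes $0,\dots,k$ ($k\ge 1$) with buying costs $0\le b_0<b_1<\dots<b_k$ and rental rates $r_0>r_1>\dots>r_k\ge 0$. The optimal offline cost of a game of length $t\ge 0$ is $\mathrm{opt}(t)=\min_i(b_i+r_it)$. A deterministic strategy is a sequence $t_1\le\dots\le t_k$ in $[0,\infty]$, where $t_i$ is the time of the transition from slope $i-1$ to slope $i$ ($t_i=\infty$ if it is never made); a randomized strategy is a probability distribution over deterministic strategies. If $p_i(t)$ is the probability that the strategy is in slope $i$ at time $t$ (the functions $p_i$ form its profile), its expected total cost up to time $t$ is $X_p(t)=\sum_i p_i(t)b_i+\int_0^t\sum_i p_i(z)r_i\,dz$. The strategy is $c$-competitive if $X_p(t)\le c\cdot\mathrm{opt}(t)$ for all $t\ge 0$, and the optimal randomized competitive ratio of the instance is the infimum of all $c$ for which a $c$-competitive randomized strategy exists. **Theorem.** There are a constant $C$ and a single program for the real random access machine (with unit-cost operations $+,-,\times,/,\exp,\ln$ and comparisons on real numbers, indexed memory, and natural numbers as the only program constants) such that the following holds for every $k\ge 1$, every instance as above with optimal randomized competitive ratio $c$,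 and every $0<\varepsilon\le\frac12$. On input $k,(b_i)_i,(r_i)_i,\varepsilon$ the program halts after at most $C\,k\log\frac1\varepsilon$ steps and outputs a $(c+\varepsilon)$-competitive randomized strategy. The strategy is output as an explicit profile: a finite list of consecutive time intervals that cover $[0,\infty)$, each with two slopes $\ell,u$ and three reals $A,\Gamma,\alpha$, meaning that at a time $t$ in the interval the strategy is in slope $u$ with probability $A+\Gamma e^{\alpha t}$ and otherwise in slope $\ell$. The strategy with this profile draws $U$ uniformly from $[0,1]$ and takes for $t_i$ the first time $t$ at which $\sum_{j\ge i}p_j(t)\ge U$. -/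

import Mathlib

open MeasureTheory
open scoped ENNReal

noncomputable section

/-! ## Additive multislope ski rental -/

namespace SkiRental

/-- An instance with `k + 1` slopes: slope `i` has buying cost `b i` and rental rate `r i`; the
slopes are listed by increasing buying cost and decreasing rental rate. -/
structure Instance (k : ℕ) where
  b : Fin (k + 1) → ℝ
  r : Fin (k + 1) → ℝ
  b_strictMono : StrictMono b
  r_strictAnti : StrictAnti r
  b_nonneg : ∀ i, 0 ≤ b i
  r_nonneg : ∀ i, 0 ≤ r i

variable {k : ℕ}

/-- The optimal offline cost of a game that ends at time `t`. -/
def Instance.opt (M : Instance k) (t : ℝ) : ℝ := ⨅ i, (M.b i + M.r i * t)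

/-- A deterministic strategy is the sequence of its transition times: entry `j` is the time in
`[0, ∞]` of the transition from slope `j` to slope `j + 1` (`∞` if it is never made). -/
abbrev Times (k : ℕ) : Type := Fin k → ℝ≥0∞

/-- The slope in use at time `t`: the number of transitions made up to time `t`. -/
def Times.slope (T : Times k) (t : ℝ) : Fin (k + 1) :=
  ⟨(Finset.univ.filter fun j => T j ≤ ENNReal.ofReal t).card,
    Nat.lt_succ_of_le ((Finset.card_le_univ _).trans_eq (Fintype.card_fin k))⟩

/-- A randomized strategy is a probability distribution over the deterministic strategies, the
nondecreasing sequences of transition times. -/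
structure IsStrategy (μ : Measure (Times k)) : Prop where
  isProbabilityMeasure : IsProbabilityMeasure μ
  monotone : ∀ᵐ T ∂μ, Monotone T

/-- A randomized profile: `p t i` is the probability to be in slope `i` at time `t ≥ 0`. -/
abbrev Profile (k : ℕ) : Type := ℝ → Fin (k + 1) → ℝ

/-- The profile of a randomized strategy. -/
def profileOf (μ : Measure (Times k)) : Profile k := fun t i => μ.real {T | T.slope t = i}

/-- The expected rental cost rate `R_p(t)`. -/
def Instance.rentRate (M : Instance k) (p : Profile k) (t : ℝ) : ℝ := ∑ i, p t i * M.r i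

/-- The expected total buying cost `B_p(t)` up to time `t`. -/
def Instance.buyCost (M : Instance k) (p : Profile k) (t : ℝ) : ℝ := ∑ i, p t i * M.b i

/-- The expected total cost `X_p(t)` up to time `t`. -/
def Instance.totalCost (M : Instance k) (p : Profile k) (t : ℝ) : ℝ :=
  M.buyCost p t + ∫ z in (0 : ℝ)..t, M.rentRate p z

/-- The randomized strategy `μ` is `c`-competitive: whenever the game ends, its expected cost is at
most `c` times the optimal offline cost. -/
def IsCompetitive (M : Instance k) (μ : Measure (Times k)) (c : ℝ) : Prop :=
  ∀ t : ℝ, 0 ≤ t → M.totalCost (profileOf μ) t ≤ c * M.opt t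

/-- The competitive factors that randomized strategies achieve. -/
def Instance.achievable (M : Instance k) : Set ℝ :=
  {c | ∃ μ : Measure (Times k), IsStrategy μ ∧ IsCompetitive M μ c}

/-- The strategy given by a profile `p`: draw `u` uniformly from `[0, 1]` and enter slope `j + 1`
(or a later one) at the first time `t` at which `∑_{i > j} p_i(t)` reaches `u`. -/
def strategyOf (p : Profile k) : Measure (Times k) :=
  (volume.restrict (Set.Icc (0 : ℝ) 1)).map fun u j =>
    sInf (ENNReal.ofReal '' {t : ℝ | 0 ≤ t ∧ u ≤ ∑ i ∈ Finset.Ici j.succ, p t i})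

end SkiRental

/-! ## A real random access machine

Structured programs over arrays of natural numbers (used for indices and counters) and arrays of
real numbers. The primitive operations on reals are `+, -, *, /, exp, log` and comparison; the only
constants in a program are natural numbers, and reals are never converted to naturals. Every
elementary operation (constant, memory access, arithmetical operation, comparison, connective,
assignment) takes one step. -/

namespace RealRAM

/-- The memory: cell `i` of the array with name `a`. -/
structure Store where
  nat : ℕ → ℕ → ℕ
  real : ℕ → ℕ → ℝ

def Store.setNat (σ : Store) (a i v : ℕ) : Store :=
  { σ with nat := Function.update σ.nat a (Function.update (σ.nat a) i v) }

def Store.setReal (σ : Store) (a i : ℕ) (v : ℝ) : Store :=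
  { σ with real := Function.update σ.real a (Function.update (σ.real a) i v) }

/-- Expressions with values in the natural numbers. -/
inductive NatExp : Type
  | lit (n : ℕ)
  | get (a : ℕ) (i : NatExp)
  | add (x y : NatExp)
  | sub (x y : NatExp)

def NatExp.eval (σ : Store) : NatExp → ℕ
  | lit n => n
  | get a i => σ.nat a (i.eval σ)
  | add x y => x.eval σ + y.eval σ
  | sub x y => x.eval σ - y.eval σ

/-- The number of steps that the evaluation takes. -/
def NatExp.cost : NatExp → ℕ
  | lit _ => 1
  | get _ i => i.cost + 1
  | add x y => x.cost + y.cost + 1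
  | sub x y => x.cost + y.cost + 1

/-- Expressions with values in the real numbers. -/
inductive RealExp : Type
  | lit (n : ℕ)
  | get (a : ℕ) (i : NatExp)
  | add (x y : RealExp)
  | sub (x y : RealExp)
  | mul (x y : RealExp)
  | div (x y : RealExp)
  | exp (x : RealExp)
  | log (x : RealExp)

/-- A quotient by zero and the logarithm of zero have the value `0`, and the logarithm of a negative
number is that of its absolute value. -/
def RealExp.eval (σ : Store) : RealExp → ℝ
  | lit n => n
  | get a i => σ.real a (i.eval σ)
  | add x y => x.eval σ + y.eval σ
  | sub x y => x.eval σ - y.eval σ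
  | mul x y => x.eval σ * y.eval σ
  | div x y => x.eval σ / y.eval σ
  | exp x => Real.exp (x.eval σ)
  | log x => Real.log (x.eval σ)

/-- The number of steps that the evaluation takes. -/
def RealExp.cost : RealExp → ℕ
  | lit _ => 1
  | get _ i => i.cost + 1
  | add x y => x.cost + y.cost + 1
  | sub x y => x.cost + y.cost + 1
  | mul x y => x.cost + y.cost + 1
  | div x y => x.cost + y.cost + 1
  | exp x => x.cost + 1
  | log x => x.cost + 1

/-- Tests. -/
inductive Test : Type
  | natLe (x y : NatExp)
  | realLe (x y : RealExp)
  | not (s : Test)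
  | and (s t : Test)

def Test.eval (σ : Store) : Test → Prop
  | natLe x y => x.eval σ ≤ y.eval σ
  | realLe x y => x.eval σ ≤ y.eval σ
  | not s => ¬ s.eval σ
  | and s t => s.eval σ ∧ t.eval σ

/-- The number of steps that the evaluation takes. -/
def Test.cost : Test → ℕ
  | natLe x y => x.cost + y.cost + 1
  | realLe x y => x.cost + y.cost + 1
  | not s => s.cost + 1
  | and s t => s.cost + t.cost + 1

/-- Programs: `setNat a i e` and `setReal a i e` are the assignments `a[i] := e`, `cond` is
`if … then … else …`, and `loop` is `while … do …`. -/
inductive Prog : Type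
  | skip
  | setNat (a : ℕ) (i : NatExp) (e : NatExp)
  | setReal (a : ℕ) (i : NatExp) (e : RealExp)
  | seq (P Q : Prog)
  | cond (s : Test) (P Q : Prog)
  | loop (s : Test) (P : Prog)

/-- `Runs P σ n τ`: started on the memory `σ`, the program `P` halts after exactly `n` steps with
the memory `τ`. -/
inductive Runs : Prog → Store → ℕ → Store → Prop
  | skip (σ : Store) : Runs .skip σ 1 σ
  | setNat (a : ℕ) (i e : NatExp) (σ : Store) :
      Runs (.setNat a i e) σ (i.cost + e.cost + 1) (σ.setNat a (i.eval σ) (e.eval σ))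
  | setReal (a : ℕ) (i : NatExp) (e : RealExp) (σ : Store) :
      Runs (.setReal a i e) σ (i.cost + e.cost + 1) (σ.setReal a (i.eval σ) (e.eval σ))
  | seq {P Q : Prog} {σ τ ρ : Store} {m n : ℕ} :
      Runs P σ m τ → Runs Q τ n ρ → Runs (.seq P Q) σ (m + n) ρ
  | condTrue {s : Test} {P Q : Prog} {σ τ : Store} {n : ℕ} :
      s.eval σ → Runs P σ n τ → Runs (.cond s P Q) σ (s.cost + n) τ
  | condFalse {s : Test} {P Q : Prog} {σ τ : Store} {n : ℕ} :
      ¬ s.eval σ → Runs Q σ n τ → Runs (.cond s P Q) σ (s.cost + n) τ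
  | loopTrue {s : Test} {P : Prog} {σ τ ρ : Store} {m n : ℕ} :
      s.eval σ → Runs P σ m τ → Runs (.loop s P) τ n ρ →
        Runs (.loop s P) σ (s.cost + m + n) ρ
  | loopFalse {s : Test} {P : Prog} {σ : Store} :
      ¬ s.eval σ → Runs (.loop s P) σ s.cost σ

end RealRAM

/-! ## Input and output of the machine -/

namespace SkiRental

variable {k : ℕ}

/-- The initial memory: `k` is in cell `0` of the natural array `0`; the buying costs, the rental
rates and the precision `ε` are in the real arrays `0`, `1` and `2`; all other cells are `0`. -/
def inputStore (M : Instance k) (ε : ℝ) : RealRAM.Store where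
  nat a i := if a = 0 ∧ i = 0 then k else 0
  real a i :=
    if a = 0 then (if h : i < k + 1 then M.b ⟨i, h⟩ else 0)
    else if a = 1 then (if h : i < k + 1 then M.r ⟨i, h⟩ else 0)
    else if a = 2 ∧ i = 0 then ε
    else 0

/-- An explicit description of a profile by `size` pieces. Piece `m` lasts from time `start m` to
the start of the next piece (forever, if it is the last one). During piece `m` the slope is
`upper m` with probability `const m + coef m * exp (rate m * t)`, and otherwise it is `lower m`. -/
structure Description where
  size : ℕ
  start : ℕ → ℝ
  lower : ℕ → ℕ
  upper : ℕ → ℕ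
  const : ℕ → ℝ
  coef : ℕ → ℝ
  rate : ℕ → ℝ

/-- The pieces are listed in order of time, cover `[0, ∞)` and refer to the slopes `0, …, k`. -/
structure Description.WellFormed (D : Description) (k : ℕ) : Prop where
  size_pos : 0 < D.size
  start_zero : D.start 0 = 0
  start_le : ∀ m, m + 1 < D.size → D.start m ≤ D.start (m + 1)
  lower_le : ∀ m, m < D.size → D.lower m ≤ k
  upper_le : ∀ m, m < D.size → D.upper m ≤ k

/-- The index of the last piece that starts at or before time `t`. -/
def Description.pieceAt (D : Description) (t : ℝ) : ℕ :=
  ((Finset.range D.size).filter fun m => D.start m ≤ t).sup id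

/-- The profile that is described. -/
def Description.profile (D : Description) (k : ℕ) : Profile k := fun t i =>
  let m := D.pieceAt t
  let q := D.const m + D.coef m * Real.exp (D.rate m * t)
  (if (i : ℕ) = D.upper m then q else 0) + (if (i : ℕ) = D.lower m then 1 - q else 0)

/-- The output of the machine: the number of pieces is in cell `0` of the natural array `1`, and
the entries of the pieces are in the natural arrays `2`, `3` and the real arrays `3`, …, `6`. -/
def outputDescription (σ : RealRAM.Store) : Description where
  size := σ.nat 1 0
  start := σ.real 3
  lower := σ.nat 2
  upper := σ.nat 3
  const := σ.real 4
  coef := σ.real 5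
  rate := σ.real 6

end SkiRental

end

/-!
The strategies that matter spend as much as `c`-competitiveness allows. At each time a randomized
strategy has an expected buying cost `B` and a rent rate, and the point with these coordinates lies
above the lower left hull of the points `(b i, r i)`. A strategy that always mixes the two ends of
an edge of this hull has the least rent rate `hullRate B`, and it can be run as soon as `B` never
decreases (`tailSum_mix_eq`, `IsProfile.isStrategy`, `IsProfile.profileOf_strategyOf`). If its
total cost is kept equal to `c * opt t`, then `B' = c * opt' - hullRate B`. The right-hand side is
affine in `B` as long as the optimal slope and the edge stay the same, so that `B` is given by
exponential functions on at most `2 * k + 1` pieces (`flow`). The slopes of `opt`, a lower envelope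
of lines, are the vertices of the same hull, and the times at which the optimal slope changes are
the negative reciprocals of the gradients of its edges (`IsHull.opt_le`). A scan with a stack finds
the hull in linear time (`ScanInv`).

The construction fails if `B` would have to decrease. Then there is no `c`-competitive strategy:
by a comparison principle for the differential equation (`Competitor.le_flow`), the buying cost of
such a strategy is at most `B`; as `opt` is concave, a budget `B` that has started to decrease
continues to do so until it is negative (`Competitor.nonneg_of_le`). For `c = 2` the
construction succeeds, because `B` is at least the optimal cost (`PathInv.speed_ge`). Hence a
bisection of the interval `[1, 2]` finds, in `O(log (1 / ε))` constructions with `O(k)` pieces each,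
a factor for which the construction succeeds and which is larger by at most `ε` than a lower bound
of the achievable factors.
-/

noncomputable section

/-! ### Total correctness with time bounds for programs of the machine -/

namespace RealRAM

/-- Programs without `while` loops. -/
def Prog.LoopFree : Prog → Prop
  | .skip => True
  | .setNat _ _ _ => True
  | .setReal _ _ _ => True
  | .seq P Q => P.LoopFree ∧ Q.LoopFree
  | .cond _ P Q => P.LoopFree ∧ Q.LoopFree
  | .loop _ _ => False

/-- An upper bound for the number of steps of a loop-free program. The value at a loop is
irrelevant. -/
def Prog.maxCost : Prog → ℕ
  | .skip => 1
  | .setNat _ i e => i.cost + e.cost + 1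
  | .setReal _ i e => i.cost + e.cost + 1
  | .seq P Q => P.maxCost + Q.maxCost
  | .cond s P Q => s.cost + max P.maxCost Q.maxCost
  | .loop _ _ => 0

open Classical in
/-- The memory in which a loop-free program halts. The value at a loop is irrelevant. -/
def Prog.exec : Prog → Store → Store
  | .skip, σ => σ
  | .setNat a i e, σ => σ.setNat a (i.eval σ) (e.eval σ)
  | .setReal a i e, σ => σ.setReal a (i.eval σ) (e.eval σ)
  | .seq P Q, σ => Q.exec (P.exec σ)
  | .cond s P Q, σ => if s.eval σ then P.exec σ else Q.exec σ
  | .loop _ _, σ => σ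

theorem Prog.LoopFree.runs {P : Prog} (hP : P.LoopFree) (σ : Store) :
    ∃ n, Runs P σ n (P.exec σ) ∧ n ≤ P.maxCost := by
  induction P generalizing σ with
  | skip => exact ⟨1, .skip σ, le_rfl⟩
  | setNat a i e => exact ⟨_, .setNat a i e σ, le_rfl⟩
  | setReal a i e => exact ⟨_, .setReal a i e σ, le_rfl⟩
  | seq P Q ihP ihQ =>
    obtain ⟨m, hm, hm'⟩ := ihP hP.1 σ
    obtain ⟨n, hn, hn'⟩ := ihQ hP.2 (P.exec σ)
    exact ⟨m + n, .seq hm hn, Nat.add_le_add hm' hn'⟩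
  | cond s P Q ihP ihQ =>
    by_cases hs : s.eval σ
    · obtain ⟨m, hm, hm'⟩ := ihP hP.1 σ
      refine ⟨s.cost + m, ?_, Nat.add_le_add_left (hm'.trans (le_max_left _ _)) _⟩
      simpa only [Prog.exec, if_pos hs] using Runs.condTrue hs hm
    · obtain ⟨m, hm, hm'⟩ := ihQ hP.2 σ
      refine ⟨s.cost + m, ?_, Nat.add_le_add_left (hm'.trans (le_max_right _ _)) _⟩
      simpa only [Prog.exec, if_neg hs] using Runs.condFalse hs hm
  | loop s P _ => exact hP.elim

/-- Started on `σ`, the program `P` halts after at most `K` steps with a memory that satisfies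
`Q`. -/
def Achieves (P : Prog) (σ : Store) (K : ℕ) (Q : Store → Prop) : Prop :=
  ∃ n τ, Runs P σ n τ ∧ n ≤ K ∧ Q τ

theorem Achieves.mono {P : Prog} {σ : Store} {K K' : ℕ} {Q Q' : Store → Prop}
    (h : Achieves P σ K Q) (hK : K ≤ K') (hQ : ∀ τ, Q τ → Q' τ) : Achieves P σ K' Q' := by
  obtain ⟨n, τ, hr, hn, hq⟩ := h
  exact ⟨n, τ, hr, hn.trans hK, hQ τ hq⟩

theorem Prog.LoopFree.achieves {P : Prog} (hP : P.LoopFree) {σ : Store} {Q : Store → Prop}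
    (h : Q (P.exec σ)) : Achieves P σ P.maxCost Q := by
  obtain ⟨n, hn, hn'⟩ := hP.runs σ
  exact ⟨n, _, hn, hn', h⟩

theorem Achieves.seq {P P' : Prog} {σ : Store} {K K' : ℕ} {Q Q' : Store → Prop}
    (h : Achieves P σ K Q) (h' : ∀ τ, Q τ → Achieves P' τ K' Q') :
    Achieves (.seq P P') σ (K + K') Q' := by
  obtain ⟨n, τ, hr, hn, hq⟩ := h
  obtain ⟨n', τ', hr', hn', hq'⟩ := h' τ hq
  exact ⟨n + n', τ', .seq hr hr', Nat.add_le_add hn hn', hq'⟩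

/-- A loop with an invariant `I` whose index, the variant, decreases with each execution of the
body. -/
theorem Achieves.loop {s : Test} {P : Prog} {K : ℕ} {I : ℕ → Store → Prop}
    (body : ∀ v σ, I v σ → s.eval σ → Achieves P σ K fun τ => ∃ w, w < v ∧ I w τ)
    (v : ℕ) (σ : Store) (h : I v σ) :
    Achieves (.loop s P) σ (v * (s.cost + K) + s.cost)
      fun τ => (∃ w, I w τ) ∧ ¬ s.eval τ := by
  induction v using Nat.strong_induction_on generalizing σ with
  | _ v ih =>
    by_cases hs : s.eval σ
    · obtain ⟨n, τ, hr, hn, w, hw, hI⟩ := body v σ h hs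
      obtain ⟨n', τ', hr', hn', hQ⟩ := ih w hw τ hI
      refine ⟨s.cost + n + n', τ', .loopTrue hs hr hr', ?_, hQ⟩
      calc s.cost + n + n' ≤ s.cost + K + (w * (s.cost + K) + s.cost) := by omega
        _ = (w + 1) * (s.cost + K) + s.cost := by ring
        _ ≤ _ := by gcongr; exact hw
    · exact ⟨s.cost, σ, .loopFalse hs, Nat.le_add_left _ _, ⟨v, h⟩, hs⟩

end RealRAM

/-! ### The lower envelope of the slopes -/

namespace SkiRental

/-- The requirements on the buying costs and rental rates of the slopes `0, …, k`, for sequences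
that are defined on all natural numbers. -/
structure Costs (k : ℕ) (b r : ℕ → ℝ) : Prop where
  b_lt : ∀ {i j}, i < j → j ≤ k → b i < b j
  r_lt : ∀ {i j}, i < j → j ≤ k → r j < r i
  b_nonneg : ∀ i, i ≤ k → 0 ≤ b i
  r_nonneg : ∀ i, i ≤ k → 0 ≤ r i

/-- The slopes `h 0, …, h m` are those of the lower envelope of the lines `b i + r i * t`, `t ≥ 0`,
and the envelope changes from `h j` to `h (j + 1)` at time `τ j`. Equivalently, the points
`(b (h j), r (h j))` are the vertices of the lower left hull of the points `(b i, r i)`, and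
`-1 / τ j` is the gradient of its edge number `j`. -/
structure IsHull (k : ℕ) (b r : ℕ → ℝ) (m : ℕ) (h : ℕ → ℕ) (τ : ℕ → ℝ) : Prop where
  zero : h 0 = 0
  last : h m = k
  lt_succ : ∀ j, j < m → h j < h (j + 1)
  cross : ∀ j, j < m → τ j * (r (h j) - r (h (j + 1))) = b (h (j + 1)) - b (h j)
  tau_lt : ∀ j, j + 1 < m → τ j < τ (j + 1)
  le : ∀ j, j < m → ∀ i, i ≤ k → b (h j) + τ j * r (h j) ≤ b i + τ j * r i

/-- The state of the monotone scan that computes the lower envelope, while slope `i` is added to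
the envelope `h 0, …, h m` of the slopes before it. In `tail`, after the last change of the
envelope only its last slope and the new slope count: the slopes that were removed are beaten by
the new one. -/
structure ScanInv (k : ℕ) (b r : ℕ → ℝ) (i m : ℕ) (h : ℕ → ℕ) (τ : ℕ → ℝ) : Prop where
  i_le : i ≤ k + 1
  zero : h 0 = 0
  top_lt : h m < i
  top : i = k + 1 → h m = k
  lt_succ : ∀ j, j < m → h j < h (j + 1)
  cross : ∀ j, j < m → τ j * (r (h j) - r (h (j + 1))) = b (h (j + 1)) - b (h j)
  tau_lt : ∀ j, j + 1 < m → τ j < τ (j + 1)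
  le : ∀ j, j < m → ∀ l, l < i → b (h j) + τ j * r (h j) ≤ b l + τ j * r l
  tail : ∀ t, 0 ≤ t → (∀ j, j + 1 = m → τ j ≤ t) → ∀ l, l < i →
    b (h m) + t * r (h m) ≤ b l + t * r l ∨ b i + t * r i ≤ b l + t * r l

theorem Costs.b_le {k : ℕ} {b r : ℕ → ℝ} (C : Costs k b r) {i j : ℕ} (hij : i ≤ j) (hj : j ≤ k) :
    b i ≤ b j := by
  rcases hij.eq_or_lt with rfl | hlt
  · rfl
  · exact (C.b_lt hlt hj).le

theorem Costs.r_le {k : ℕ} {b r : ℕ → ℝ} (C : Costs k b r) {i j : ℕ} (hij : i ≤ j) (hj : j ≤ k) :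
    r j ≤ r i := by
  rcases hij.eq_or_lt with rfl | hlt
  · rfl
  · exact (C.r_lt hlt hj).le

section
variable {k i m : ℕ} {b r : ℕ → ℝ} {h : ℕ → ℕ} {τ : ℕ → ℝ}

theorem ScanInv.start (h0 : h 0 = 0) (hk : 1 ≤ k) : ScanInv k b r 1 0 h τ where
  i_le := by omega
  zero := h0
  top_lt := by omega
  top := by omega
  lt_succ := by omega
  cross := by omega
  tau_lt := by omega
  le := by omega
  tail := by
    intro t _ _ l hl
    obtain rfl : l = 0 := by omega
    left; rw [h0]

theorem ScanInv.index_le (H : ScanInv k b r i m h τ) (j : ℕ) (hj : j ≤ m) : h j ≤ h m := by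
  obtain ⟨d, rfl⟩ := Nat.exists_eq_add_of_le hj
  have H' := H.lt_succ
  clear H hj
  induction d with
  | zero => rfl
  | succ d ih => exact (ih fun l hl => H' l (by omega)).trans (H' (j + d) (by omega)).le

theorem ScanInv.tau_pos (C : Costs k b r) (H : ScanInv k b r i m h τ) (j : ℕ) (hj : j < m) :
    0 < τ j := by
  have h1 := H.cross j hj
  have h2 := H.lt_succ j hj
  have h3 := H.index_le (j + 1) hj
  have h4 : h (j + 1) ≤ k := by have := H.top_lt; have := H.i_le; omega
  have hb := C.b_lt h2 h4
  have hr := C.r_lt h2 h4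
  by_contra hn
  nlinarith

/-- If the new slope is not worse than the last slope of the envelope at the time from which on the
latter is used, then the latter is dropped. -/
theorem ScanInv.pop (C : Costs k b r) (H : ScanInv k b r i (m + 1) h τ) (hi : i ≤ k)
    (hle : b i + τ m * r i ≤ b (h (m + 1)) + τ m * r (h (m + 1))) :
    ScanInv k b r i m h τ where
  i_le := H.i_le
  zero := H.zero
  top_lt := (H.lt_succ m (by omega)).trans H.top_lt
  top := by omega
  lt_succ j hj := H.lt_succ j (by omega)
  cross j hj := H.cross j (by omega)
  tau_lt j hj := H.tau_lt j (by omega)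
  le j hj := H.le j (by omega)
  tail := by
    intro t ht hlow l hl
    rcases le_total (τ m) t with hmt | hmt
    · right
      rcases H.tail t ht (fun j hj => by obtain rfl : j = m := by omega
                                         exact hmt) l hl with h1 | h1
      · have := C.r_lt H.top_lt hi
        nlinarith
      · exact h1
    · left
      have hm := H.le m (by omega) l hl
      have hpos := H.tau_pos C m (by omega)
      -- the claim holds at the ends of an interval that contains `t`
      obtain ⟨s, hs, hst, hs'⟩ : ∃ s, s < τ m ∧ s ≤ t ∧
          b (h m) + s * r (h m) ≤ b l + s * r l := by
        rcases m with _ | m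
        · refine ⟨0, hpos, ht, ?_⟩
          rw [H.zero]
          linarith [C.b_le (Nat.zero_le l) (by omega)]
        · refine ⟨τ m, H.tau_lt m (by omega), hlow m rfl, ?_⟩
          have h1 := H.le m (by omega) l hl
          have h2 := H.cross m (by omega)
          linarith
      by_contra hn
      push Not at hn
      nlinarith

/-- Otherwise the new slope becomes the last one of the envelope. By `tail`, the envelope changes to
it at the time at which its line crosses that of the last slope. -/
theorem ScanInv.push (C : Costs k b r) (H : ScanInv k b r i m h τ) (hi : i ≤ k)
    (hlt : ∀ j, j + 1 = m → b (h m) + τ j * r (h m) < b i + τ j * r i) :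
    ScanInv k b r (i + 1) (m + 1) (Function.update h (m + 1) i)
      (Function.update τ m ((b i - b (h m)) / (r (h m) - r i))) := by
  have hb := C.b_lt H.top_lt hi
  have hr := C.r_lt H.top_lt hi
  set s := (b i - b (h m)) / (r (h m) - r i) with hs
  have hs0 : 0 < s := div_pos (by linarith) (by linarith)
  have hsx : s * (r (h m) - r i) = b i - b (h m) := div_mul_cancel₀ _ (by linarith)
  have hτs : ∀ j, j + 1 = m → τ j < s := by
    intro j hj
    have := hlt j hj
    by_contra hn
    nlinarith
  have hτs' : ∀ j, j < m → τ j < s := by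
    intro j hj
    obtain ⟨d, hd⟩ : ∃ d, m = j + 1 + d := ⟨m - (j + 1), by omega⟩
    clear hlt
    induction d generalizing j with
    | zero => exact hτs j (by omega)
    | succ d ih => exact (H.tau_lt j (by omega)).trans (ih (j + 1) (by omega) (by omega))
  have hh : ∀ j, j ≤ m → Function.update h (m + 1) i j = h j := fun j hj =>
    Function.update_of_ne (by omega) _ _
  have hτ : ∀ j, j < m → Function.update τ m s j = τ j := fun j hj =>
    Function.update_of_ne (by omega) _ _
  refine ⟨by omega, ?_, ?_, ?_, ?_, ?_, ?_, ?_, ?_⟩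
  · rw [hh 0 (by omega), H.zero]
  · rw [Function.update_self]; omega
  · intro _; rw [Function.update_self]; omega
  · intro j hj
    rw [hh j (by omega)]
    rcases Nat.lt_or_ge j m with h1 | h1
    · rw [hh (j + 1) h1]; exact H.lt_succ j h1
    · obtain rfl : j = m := by omega
      rw [Function.update_self]; exact H.top_lt
  · intro j hj
    rw [hh j (by omega)]
    rcases Nat.lt_or_ge j m with h1 | h1
    · rw [hh (j + 1) h1, hτ j h1]; exact H.cross j h1
    · obtain rfl : j = m := by omega
      rw [Function.update_self, Function.update_self]; exact hsx
  · intro j hj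
    rw [hτ j (by omega)]
    rcases Nat.lt_or_ge (j + 1) m with h1 | h1
    · rw [hτ (j + 1) h1]; exact H.tau_lt j h1
    · obtain rfl : j + 1 = m := by omega
      rw [Function.update_self]; exact hτs j rfl
  · intro j hj l hl
    rw [hh j (by omega)]
    rcases Nat.lt_or_ge j m with h1 | h1
    · rw [hτ j h1]
      rcases Nat.lt_or_ge l i with h2 | h2
      · exact H.le j h1 l h2
      · obtain rfl : l = i := by omega
        have h3 := H.le j h1 (h m) H.top_lt
        have h4 := hτs' j h1
        nlinarith
    · obtain rfl : j = m := by omega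
      rw [Function.update_self]
      rcases Nat.lt_or_ge l i with h2 | h2
      · rcases H.tail s hs0.le (fun j' hj' => (hτs j' hj').le) l h2 with h3 | h3
        · exact h3
        · linarith
      · obtain rfl : l = i := by omega
        linarith
  · intro t ht hlow l hl
    have hst : s ≤ t := by simpa using hlow m rfl
    left
    rw [Function.update_self]
    rcases Nat.lt_or_ge l i with h2 | h2
    · rcases H.tail t ht (fun j' hj' => (hτs j' hj').le.trans hst) l h2 with h3 | h3
      · nlinarith
      · exact h3
    · obtain rfl : l = i := by omega
      rfl

theorem ScanInv.isHull (H : ScanInv k b r i m h τ) (hi : k < i) : IsHull k b r m h τ := by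
  obtain rfl : i = k + 1 := by have := H.i_le; omega
  exact ⟨H.zero, H.top rfl, H.lt_succ, H.cross, H.tau_lt,
    fun j hj l hl => H.le j hj l (by omega)⟩

theorem IsHull.strict (H : IsHull k b r m h τ) {j j' : ℕ} (hj : j < j') (hj' : j' ≤ m) :
    h j < h j' := by
  obtain ⟨d, rfl⟩ := Nat.exists_eq_add_of_lt hj
  clear hj
  induction d with
  | zero => exact H.lt_succ j (by omega)
  | succ d ih => exact (ih (by omega)).trans (H.lt_succ (j + d + 1) (by omega))

theorem IsHull.mono (H : IsHull k b r m h τ) {j j' : ℕ} (hj : j ≤ j') (hj' : j' ≤ m) :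
    h j ≤ h j' := by
  rcases hj.eq_or_lt with rfl | hlt
  · rfl
  · exact (H.strict hlt hj').le

theorem IsHull.le_k (H : IsHull k b r m h τ) {j : ℕ} (hj : j ≤ m) : h j ≤ k :=
  (H.mono hj le_rfl).trans_eq H.last

theorem IsHull.le_index (H : IsHull k b r m h τ) {j : ℕ} (hj : j ≤ m) : j ≤ h j := by
  induction j with
  | zero => omega
  | succ j ih => have := ih (by omega); have := H.lt_succ j (by omega); omega

theorem IsHull.pos (H : IsHull k b r m h τ) (hk : 1 ≤ k) : 0 < m := by
  by_contra hm
  have h1 := H.last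
  obtain rfl : m = 0 := by omega
  rw [H.zero] at h1
  omega

theorem IsHull.b_succ (C : Costs k b r) (H : IsHull k b r m h τ) {j : ℕ} (hj : j < m) :
    b (h j) < b (h (j + 1)) := C.b_lt (H.lt_succ j hj) (H.le_k hj)

theorem IsHull.r_succ (C : Costs k b r) (H : IsHull k b r m h τ) {j : ℕ} (hj : j < m) :
    r (h (j + 1)) < r (h j) := C.r_lt (H.lt_succ j hj) (H.le_k hj)

theorem IsHull.tau_pos (C : Costs k b r) (H : IsHull k b r m h τ) {j : ℕ} (hj : j < m) :
    0 < τ j := by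
  have h1 := H.cross j hj
  have hb := H.b_succ C hj
  have hr := H.r_succ C hj
  by_contra hn
  nlinarith

/-- Slope `h e` is optimal at the times from `τ (e - 1)` to `τ e`. -/
theorem IsHull.opt_le (C : Costs k b r) (H : IsHull k b r m h τ) {e : ℕ} (he : e ≤ m) {t : ℝ}
    (ht : 0 ≤ t) (h1 : ∀ d, d + 1 = e → τ d ≤ t) (h2 : e < m → t ≤ τ e) {i : ℕ} (hi : i ≤ k) :
    b (h e) + r (h e) * t ≤ b i + r i * t := by
  obtain ⟨s, hst, hs, hs0⟩ : ∃ s, s ≤ t ∧ b (h e) + s * r (h e) ≤ b i + s * r i ∧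
      (e < m → s < τ e) := by
    rcases e with _ | e
    · refine ⟨0, ht, ?_, fun he => H.tau_pos C he⟩
      rw [H.zero]
      linarith [C.b_le (Nat.zero_le i) hi]
    · refine ⟨τ e, h1 e rfl, ?_, H.tau_lt e⟩
      have h3 := H.le e (by omega) i hi
      have h4 := H.cross e (by omega)
      linarith
  rcases Nat.lt_or_ge e m with hem | hem
  · have h3 := H.le e hem i hi
    have h4 := h2 hem
    have h5 := hs0 hem
    by_contra hn
    push Not at hn
    nlinarith
  · obtain rfl : e = m := by omega
    rw [H.last] at hs ⊢
    have : r k ≤ r i := C.r_le hi le_rfl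
    nlinarith

end

end SkiRental

/-! ### The cheapest rent rate for a given expected buying cost -/

namespace SkiRental

/-- The line through edge number `j` of the hull of the points `(b i, r i)`: the rent rate as a
function of the buying cost. -/
def edgeRate (b r : ℕ → ℝ) (h : ℕ → ℕ) (τ : ℕ → ℝ) (j : ℕ) (x : ℝ) : ℝ :=
  r (h j) - (x - b (h j)) / τ j

/-- The maximum of the lines through the edges, whose graph over `[b 0, b k]` is the hull: the least
rent rate of a distribution of slopes with expected buying cost `x`. For `m = 0` there is no edge,
and the value is irrelevant. -/
def hullRate (b r : ℕ → ℝ) (m : ℕ) (h : ℕ → ℕ) (τ : ℕ → ℝ) (x : ℝ) : ℝ :=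
  (Finset.range (m - 1 + 1)).sup' Finset.nonempty_range_add_one fun j => edgeRate b r h τ j x

section
variable {k m j e : ℕ} {b r : ℕ → ℝ} {h : ℕ → ℕ} {τ : ℕ → ℝ} {c : ℝ}

theorem continuous_edgeRate : Continuous (edgeRate b r h τ j) := by
  unfold edgeRate; fun_prop

theorem continuous_hullRate : Continuous (hullRate b r m h τ) :=
  Continuous.finset_sup'_apply _ fun _ _ => continuous_edgeRate

theorem edgeRate_apply_le (C : Costs k b r) (H : IsHull k b r m h τ) (hj : j < m) {i : ℕ}
    (hi : i ≤ k) : edgeRate b r h τ j (b i) ≤ r i := by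
  have h1 := H.le j hj i hi
  have h2 := H.tau_pos C hj
  rw [edgeRate, sub_le_iff_le_add, ← sub_le_iff_le_add', le_div_iff₀ h2]
  linarith

theorem edgeRate_eq (C : Costs k b r) (H : IsHull k b r m h τ) (hj : j < m) (q : ℝ) :
    edgeRate b r h τ j (b (h j) + (b (h (j + 1)) - b (h j)) * q) =
      r (h j) - (r (h j) - r (h (j + 1))) * q := by
  have h2 := H.tau_pos C hj
  rw [edgeRate, ← H.cross j hj]
  field_simp
  ring

/-- Over edge `j`, the line through this edge is the largest one: the other lines are below the hull
at both ends of the edge. -/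
theorem hullRate_eq (C : Costs k b r) (H : IsHull k b r m h τ) (hj : j < m) {x : ℝ}
    (h1 : b (h j) ≤ x) (h2 : x ≤ b (h (j + 1))) :
    hullRate b r m h τ x = edgeRate b r h τ j x := by
  apply le_antisymm
  · apply Finset.sup'_le
    intro l hl
    have hl : l < m := by have := Finset.mem_range.1 hl; omega
    have hb := H.b_succ C hj
    obtain ⟨q, rfl⟩ : ∃ q, x = b (h j) + (b (h (j + 1)) - b (h j)) * q :=
      ⟨(x - b (h j)) / (b (h (j + 1)) - b (h j)), by
        rw [mul_div_cancel₀ _ (by linarith)]; ring⟩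
    rw [edgeRate_eq C H hj]
    have hq0 : 0 ≤ q := by by_contra hn; nlinarith
    have hq1 : q ≤ 1 := by by_contra hn; nlinarith
    have e1 := edgeRate_apply_le C H hl (H.le_k hj.le)
    have e2 := edgeRate_apply_le C H hl (H.le_k hj)
    calc edgeRate b r h τ l (b (h j) + (b (h (j + 1)) - b (h j)) * q)
        = (1 - q) * edgeRate b r h τ l (b (h j)) + q * edgeRate b r h τ l (b (h (j + 1))) := by
          unfold edgeRate; ring
      _ ≤ (1 - q) * r (h j) + q * r (h (j + 1)) := by
          have : 0 ≤ 1 - q := by linarith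
          gcongr
      _ = _ := by ring
  · exact Finset.le_sup' (fun j => edgeRate b r h τ j x) (Finset.mem_range.2 (by omega))

/-! ### Spending at the largest rate that `c`-competitiveness allows -/

/-- The function with value `b (h j) + Δ * (X - G)` at time `t₀`, where `Δ` is the length of edge
`j` in the direction of the buying costs, that solves `Y' = c * r (h e) - edgeRate j Y` if `G` is
`gap r h c j e`. -/
def flow (b : ℕ → ℝ) (h : ℕ → ℕ) (τ : ℕ → ℝ) (j : ℕ) (G X t₀ t : ℝ) : ℝ :=
  b (h j) + (b (h (j + 1)) - b (h j)) * (-G + X * Real.exp ((t - t₀) / τ j))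

/-- The gap `c * r (h e) - r (h j)` between the spending rate that is allowed and the rent rate at
the start of edge `j`, relative to the change of the rent rate along the edge. -/
def gap (r : ℕ → ℝ) (h : ℕ → ℕ) (c : ℝ) (j e : ℕ) : ℝ :=
  (c * r (h e) - r (h j)) / (r (h j) - r (h (j + 1)))

/-- Where on edge `j` the buying cost `B` lies: `0` at its start and `1` at its end. -/
def position (b : ℕ → ℝ) (h : ℕ → ℕ) (j : ℕ) (B : ℝ) : ℝ :=
  (B - b (h j)) / (b (h (j + 1)) - b (h j))

theorem gap_mul (C : Costs k b r) (H : IsHull k b r m h τ) (hj : j < m) :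
    (r (h j) - r (h (j + 1))) * gap r h c j e = c * r (h e) - r (h j) := by
  have := H.r_succ C hj
  rw [gap, mul_div_cancel₀]
  linarith

theorem position_mul (C : Costs k b r) (H : IsHull k b r m h τ) (hj : j < m) (B : ℝ) :
    (b (h (j + 1)) - b (h j)) * position b h j B = B - b (h j) := by
  have := H.b_succ C hj
  rw [position, mul_div_cancel₀]
  linarith

theorem flow_start (C : Costs k b r) (H : IsHull k b r m h τ) (hj : j < m) (G B t₀ : ℝ) :
    flow b h τ j G (position b h j B + G) t₀ t₀ = B := by
  have := position_mul C H hj B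
  simp only [flow, sub_self, zero_div, Real.exp_zero]
  linarith

theorem hasDerivAt_flow (C : Costs k b r) (H : IsHull k b r m h τ) (hj : j < m) (X t₀ t : ℝ) :
    HasDerivAt (flow b h τ j (gap r h c j e) X t₀)
      (c * r (h e) - edgeRate b r h τ j (flow b h τ j (gap r h c j e) X t₀ t)) t := by
  have h1 : HasDerivAt (fun t => Real.exp ((t - t₀) / τ j))
      (Real.exp ((t - t₀) / τ j) * (1 / τ j)) t :=
    (((hasDerivAt_id t).sub_const t₀).div_const (τ j)).exp
  have h2 := (((h1.const_mul X).const_add (-gap r h c j e)).const_mul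
    (b (h (j + 1)) - b (h j))).const_add (b (h j))
  refine h2.congr_deriv ?_
  rw [flow, edgeRate_eq C H hj, ← H.cross j hj]
  have h3 := H.tau_pos C hj
  have h4 := gap_mul (c := c) (e := e) C H hj
  field_simp
  linarith

theorem flow_mono (C : Costs k b r) (H : IsHull k b r m h τ) (hj : j < m) {G X t₀ : ℝ}
    (hX : 0 ≤ X) : Monotone (flow b h τ j G X t₀) := by
  intro s t hst
  have h1 := H.b_succ C hj
  have h2 := H.tau_pos C hj
  have h3 : 0 ≤ b (h (j + 1)) - b (h j) := by linarith
  unfold flow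
  gcongr

theorem continuous_flow {G X t₀ : ℝ} : Continuous (flow b h τ j G X t₀) := by
  unfold flow; fun_prop

/-! ### Every competitive strategy buys less -/

/-- The rent rate `R` and the expected buying cost `S` of a `c`-competitive randomized strategy, as
functions of time. -/
structure Competitor (k : ℕ) (b r : ℕ → ℝ) (m : ℕ) (h : ℕ → ℕ) (τ : ℕ → ℝ) (c : ℝ)
    (R S : ℝ → ℝ) : Prop where
  integrable : ∀ s t, IntervalIntegrable R volume s t
  edge_le : ∀ j, j < m → ∀ t, edgeRate b r h τ j (S t) ≤ R t
  zero_le : ∀ t, b 0 ≤ S t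
  cost_le : ∀ t, 0 ≤ t → ∀ i, i ≤ k → S t + ∫ z in (0 : ℝ)..t, R z ≤ c * (b i + r i * t)

/-- The comparison principle: if until time `t₀` a competitor has rented for at least the amount
that leaves it with the budget `Y t₀` for buying, and `Y` follows the flow from then on, then the
same holds after time `t₀`. The difference satisfies a linear differential inequality because
`edgeRate j` is linear and bounds the rent rate from below everywhere. -/
theorem Competitor.le_flow {R S : ℝ → ℝ} (A : Competitor k b r m h τ c R S) (C : Costs k b r)
    (H : IsHull k b r m h τ) (hj : j < m) (he : e ≤ m) {Y : ℝ → ℝ} {t₀ t : ℝ}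
    (hY : ∀ s, HasDerivAt Y (c * r (h e) - edgeRate b r h τ j (Y s)) s)
    (h0 : 0 ≤ t₀) (ht : t₀ ≤ t)
    (hst : c * (b (h e) + r (h e) * t₀) ≤ Y t₀ + ∫ z in (0 : ℝ)..t₀, R z) :
    c * (b (h e) + r (h e) * t) ≤ Y t + ∫ z in (0 : ℝ)..t, R z := by
  have hτ := H.tau_pos C hj
  have hYc : Continuous Y := continuous_iff_continuousAt.2 fun s => (hY s).continuousAt
  set D : ℝ → ℝ := fun s => c * (b (h e) + r (h e) * s) - Y s - ∫ z in (0 : ℝ)..s, R z with hD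
  have hDc : Continuous D := by
    have := intervalIntegral.continuous_primitive A.integrable 0
    fun_prop
  have hint : ∀ x z, t₀ ≤ x → x ≤ z → D z - D x ≤ ∫ s in x..z, (1 / τ j) * D s := by
    intro x z hx hxz
    have e1 : ∫ s in x..z, (c * r (h e) - (c * r (h e) - edgeRate b r h τ j (Y s))) =
        (c * r (h e) * z - Y z) - (c * r (h e) * x - Y x) := by
      apply intervalIntegral.integral_eq_sub_of_hasDerivAt
      · intro s _
        exact (((hasDerivAt_id s).const_mul (c * r (h e))).sub (hY s)).congr_deriv (by simp)
      · have := continuous_edgeRate (b := b) (r := r) (h := h) (τ := τ) (j := j)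
        exact Continuous.intervalIntegrable (by fun_prop) _ _
    have e2 := intervalIntegral.integral_add_adjacent_intervals (A.integrable 0 x)
      (A.integrable x z)
    have e3 : IntervalIntegrable
        (fun s => c * r (h e) - (c * r (h e) - edgeRate b r h τ j (Y s))) volume x z := by
      have := continuous_edgeRate (b := b) (r := r) (h := h) (τ := τ) (j := j)
      exact Continuous.intervalIntegrable (by fun_prop) _ _
    have e4 : D z - D x =
        ∫ s in x..z, (c * r (h e) - (c * r (h e) - edgeRate b r h τ j (Y s)) - R s) := by
      rw [intervalIntegral.integral_sub e3 (A.integrable x z), e1, hD]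
      dsimp only
      rw [← e2]
      ring
    rw [e4]
    refine intervalIntegral.integral_mono_on hxz (e3.sub (A.integrable x z))
      (Continuous.intervalIntegrable (by fun_prop) _ _) ?_
    intro s hs
    have f1 := A.edge_le j hj s
    have f2 := A.cost_le s (h0.trans (hx.trans hs.1)) (h e) (H.le_k he)
    have f3 : edgeRate b r h τ j (Y s) - edgeRate b r h τ j (S s) = (1 / τ j) * (S s - Y s) := by
      unfold edgeRate; ring
    have f4 : (1 / τ j) * (S s - Y s) ≤ (1 / τ j) * D s := by
      have : 0 ≤ 1 / τ j := by positivity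
      refine mul_le_mul_of_nonneg_left ?_ this
      simp only [hD]
      linarith
    linarith
  have key := le_gronwallBound_of_liminf_deriv_right_le (f := D) (f' := fun s => (1 / τ j) * D s)
    (δ := 0) (K := 1 / τ j) (ε := 0) (a := t₀) (b := t) hDc.continuousOn ?_ ?_ ?_ t
    ⟨ht, le_rfl⟩
  · simp only [gronwallBound_ε0, zero_mul] at key
    simp only [hD] at key
    linarith
  · intro x hx ρ hρ
    have hev : ∀ᶠ z in nhds x, (1 / τ j) * D z < ρ :=
      (continuous_const.mul hDc).continuousAt.eventually_lt continuousAt_const hρ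
    obtain ⟨δ, hδ, hball⟩ := Metric.eventually_nhds_iff_ball.1 hev
    apply Filter.Eventually.frequently
    filter_upwards [Ioo_mem_nhdsGT (show x < x + δ / 2 by linarith)] with z hz
    -- the mean of the continuous function `D / τ` over `[x, z]` is smaller than `ρ`
    have hzx : 0 < z - x := by linarith [hz.1]
    obtain ⟨w, hw, hmax⟩ := isCompact_Icc.exists_isMaxOn (Set.nonempty_Icc.2 hz.1.le)
      (continuous_const.mul hDc : Continuous fun s => (1 / τ j) * D s).continuousOn
    have hwρ : (1 / τ j) * D w < ρ := by
      apply hball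
      rw [Metric.mem_ball, Real.dist_eq, abs_lt]
      constructor <;> linarith [hw.1, hw.2, hz.1, hz.2]
    have hle : ∫ s in x..z, (1 / τ j) * D s ≤ ∫ _ in x..z, (1 / τ j) * D w :=
      intervalIntegral.integral_mono_on hz.1.le
        (Continuous.intervalIntegrable (by fun_prop) _ _) (by simp) fun s hs => hmax hs
    rw [intervalIntegral.integral_const, smul_eq_mul] at hle
    have := hint x z hx.1 hz.1.le
    rw [inv_mul_lt_iff₀ hzx]
    nlinarith
  · simp only [hD]; linarith
  · intro x _; simp

/-- If the spending rate that is allowed falls below the rent rate, then no strategy is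
`c`-competitive: the budget for buying drops to `-∞`. -/
theorem Competitor.nonneg_of_le {R S : ℝ → ℝ} (A : Competitor k b r m h τ c R S)
    (C : Costs k b r) (H : IsHull k b r m h τ) (hj : j < m) (he : e ≤ m) {B t₀ : ℝ}
    (h0 : 0 ≤ t₀)
    (hst : c * (b (h e) + r (h e) * t₀) ≤ B + ∫ z in (0 : ℝ)..t₀, R z) :
    0 ≤ position b h j B + gap r h c j e := by
  by_contra hn
  push Not at hn
  set X := position b h j B + gap r h c j e with hX
  have hb := H.b_succ C hj
  have hτ := H.tau_pos C hj
  have hΔ : 0 < b (h (j + 1)) - b (h j) := by linarith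
  set Δ := b (h (j + 1)) - b (h j) with hΔ'
  have hlim : Filter.Tendsto (fun t => flow b h τ j (gap r h c j e) X t₀ t) Filter.atTop
      Filter.atBot := by
    have h1 : Filter.Tendsto (fun t : ℝ => (t - t₀) / τ j) Filter.atTop Filter.atTop :=
      (Filter.tendsto_atTop_add_const_right _ (-t₀) Filter.tendsto_id).atTop_div_const hτ
    have h2 := (Real.tendsto_exp_atTop.comp h1).const_mul_atTop_of_neg hn
    have h3 := (Filter.tendsto_atBot_add_const_left _ (-gap r h c j e) h2).const_mul_atBot hΔ
    exact Filter.tendsto_atBot_add_const_left _ (b (h j)) h3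
  obtain ⟨t, ht, ht'⟩ := ((hlim.eventually_lt_atBot (b 0)).and
    (Filter.eventually_ge_atTop t₀)).exists
  have h1 := A.le_flow C H hj he (hasDerivAt_flow C H hj X t₀) h0 ht'
    (by rw [hX, flow_start C H hj]; exact hst)
  have h2 := A.cost_le t (h0.trans ht') (h e) (H.le_k he)
  have h3 := A.zero_le t
  linarith

end

end SkiRental

/-! ### The pieces of the profile -/

namespace SkiRental

/-- Add a piece at the end of a description. The entry of `start` after the last piece holds the
time at which that piece ends; here it becomes `t`. -/
def Description.push (D : Description) (l u : ℕ) (A Γ α t : ℝ) : Description where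
  size := D.size + 1
  start := Function.update D.start (D.size + 1) t
  lower := Function.update D.lower D.size l
  upper := Function.update D.upper D.size u
  const := Function.update D.const D.size A
  coef := Function.update D.coef D.size Γ
  rate := Function.update D.rate D.size α

/-- At time `t`, piece `n` distributes the probability between the ends of an edge of the hull,
and the expected buying cost is `x`. -/
def Matches (b : ℕ → ℝ) (m : ℕ) (h : ℕ → ℕ) (D : Description) (n : ℕ) (t x : ℝ) : Prop :=
  ∃ j, j < m ∧ D.lower n = h j ∧ D.upper n = h (j + 1) ∧ b (h j) ≤ x ∧ x ≤ b (h (j + 1)) ∧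
    (b (h (j + 1)) - b (h j)) * (D.const n + D.coef n * Real.exp (D.rate n * t)) = x - b (h j)

/-- The state of the construction of a `c`-competitive strategy at time `D.start D.size`, where the
expected buying cost is `B` and has to be increased along edge `j`, and slope `h e` is optimal.

The buying cost `B` can exceed `b k` as long as the time is `0`; hence the minimum in `path`. The
field `lower` states that competitors have spent at least as much on rent, and `two` is the reason
why the construction succeeds for `c = 2`. -/
structure PathInv (k : ℕ) (b r : ℕ → ℝ) (m : ℕ) (h : ℕ → ℕ) (τ : ℕ → ℝ) (c : ℝ)
    (D : Description) (B : ℝ) (j e : ℕ) : Prop where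
  j_le : j ≤ m
  e_le : e ≤ m
  start_zero : D.start 0 = 0
  start_le : ∀ n, n < D.size → D.start n ≤ D.start (n + 1)
  left : ∀ d, d + 1 = e → τ d ≤ D.start D.size
  right : e < m → D.start D.size ≤ τ e
  b_le : b (h j) ≤ B
  two : 2 ≤ c → b (h e) + r (h e) * D.start D.size ≤ B
  lower : ∀ R S, Competitor k b r m h τ c R S →
    c * (b (h e) + r (h e) * D.start D.size) ≤ B + ∫ z in (0 : ℝ)..D.start D.size, R z
  path : ∃ f : ℝ → ℝ, Continuous f ∧ Monotone f ∧
    (∀ t, D.start D.size ≤ t → f t = min B (b k)) ∧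
    (∀ t, 0 ≤ t → t ≤ D.start D.size → ∀ i, i ≤ k →
      f t + ∫ z in (0 : ℝ)..t, hullRate b r m h τ (f z) ≤ c * (b i + r i * t)) ∧
    B + ∫ z in (0 : ℝ)..D.start D.size, hullRate b r m h τ (f z) =
      c * (b (h e) + r (h e) * D.start D.size) ∧
    ∀ n, n < D.size → ∀ t, D.start n ≤ t → t ≤ D.start (n + 1) → Matches b m h D n t (f t)

/-- The description `D` is that of a `c`-competitive strategy: its expected buying cost `f` never
decreases, and it is always spent in the way that minimizes the rent rate. -/
structure Solves (k : ℕ) (b r : ℕ → ℝ) (m : ℕ) (h : ℕ → ℕ) (τ : ℕ → ℝ) (c : ℝ)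
    (D : Description) : Prop where
  size_pos : 0 < D.size
  start_zero : D.start 0 = 0
  start_le : ∀ n, n + 1 < D.size → D.start n ≤ D.start (n + 1)
  path : ∃ f : ℝ → ℝ, Continuous f ∧ Monotone f ∧
    (∀ t, 0 ≤ t → ∀ i, i ≤ k →
      f t + ∫ z in (0 : ℝ)..t, hullRate b r m h τ (f z) ≤ c * (b i + r i * t)) ∧
    ∀ n, n < D.size → ∀ t, D.start n ≤ t → (n + 1 < D.size → t ≤ D.start (n + 1)) →
      Matches b m h D n t (f t)

section
variable {k m j e : ℕ} {b r : ℕ → ℝ} {h : ℕ → ℕ} {τ : ℕ → ℝ} {c B : ℝ} {D : Description}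

theorem Matches.push_of_lt {n : ℕ} {t x : ℝ} (hM : Matches b m h D n t x) (hn : n < D.size)
    (l u : ℕ) (A Γ α s : ℝ) : Matches b m h (D.push l u A Γ α s) n t x := by
  obtain ⟨j, h1, h2, h3, h4, h5, h6⟩ := hM
  have hn' : n ≠ D.size := hn.ne
  exact ⟨j, h1, by simpa [Description.push, hn'] using h2,
    by simpa [Description.push, hn'] using h3, h4, h5, by simpa [Description.push, hn'] using h6⟩

theorem PathInv.time_nonneg (I : PathInv k b r m h τ c D B j e) : 0 ≤ D.start D.size := by
  have key : ∀ n, n ≤ D.size → 0 ≤ D.start n := by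
    intro n hn
    induction n with
    | zero => exact I.start_zero.ge
    | succ n ih => exact (ih (by omega)).trans (I.start_le n hn)
  exact key _ le_rfl

theorem PathInv.init (C : Costs k b r) (H : IsHull k b r m h τ) (hc : 1 ≤ c) (hs : D.size = 0)
    (h0 : D.start 0 = 0) : PathInv k b r m h τ c D (c * b 0) 0 0 where
  j_le := Nat.zero_le _
  e_le := Nat.zero_le _
  start_zero := h0
  start_le := by omega
  left := by omega
  right hm := by rw [hs, h0]; exact (H.tau_pos C hm).le
  b_le := by
    rw [H.zero]
    nlinarith [C.b_nonneg 0 (Nat.zero_le _)]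
  two h2 := by
    rw [hs, h0, H.zero]
    nlinarith [C.b_nonneg 0 (Nat.zero_le _)]
  lower R S A := by simp [hs, h0, H.zero]
  path := by
    refine ⟨fun _ => min (c * b 0) (b k), continuous_const, monotone_const, fun _ _ => rfl, ?_, ?_,
      by omega⟩
    · intro t ht ht' i hi
      obtain rfl : t = 0 := le_antisymm (by rwa [hs, h0] at ht') ht
      have : b 0 ≤ b i := C.b_le (Nat.zero_le i) hi
      have h1 := min_le_left (c * b 0) (b k)
      rw [intervalIntegral.integral_same]
      nlinarith
    · simp [hs, h0, H.zero]

theorem PathInv.next_edge (I : PathInv k b r m h τ c D B j e) (hj : j < m)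
    (hB : b (h (j + 1)) ≤ B) : PathInv k b r m h τ c D B (j + 1) e :=
  { I with j_le := hj, b_le := hB }

theorem PathInv.next_slope (H : IsHull k b r m h τ) (I : PathInv k b r m h τ c D B j e)
    (he : e < m) (ht : D.start D.size = τ e) : PathInv k b r m h τ c D B j (e + 1) := by
  have key : b (h (e + 1)) + r (h (e + 1)) * D.start D.size =
      b (h e) + r (h e) * D.start D.size := by
    have := H.cross e he
    rw [ht]; linarith
  refine { I with e_le := he, left := ?_, right := ?_, two := ?_, lower := ?_, path := ?_ }
  · intro d hd
    obtain rfl : d = e := by omega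
    exact ht.ge
  · intro he'
    rw [ht]; exact (H.tau_lt e he').le
  · rw [key]; exact I.two
  · rw [key]; exact I.lower
  · rw [key]; exact I.path

/-- For `c = 2` the rate at which the expected buying cost increases, which is
`(r (h j) - r (h (j + 1))) * X` for the relative speed `X`, is at least the rent rate of the optimal
slope. -/
theorem PathInv.speed_ge (C : Costs k b r) (H : IsHull k b r m h τ)
    (I : PathInv k b r m h τ c D B j e) (hj : j < m) (hB : B < b (h (j + 1))) (h2 : 2 ≤ c) :
    r (h e) ≤ (r (h j) - r (h (j + 1))) * (position b h j B + gap r h c j e) := by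
  have h3 := I.two h2
  have hre := C.r_nonneg _ (H.le_k I.e_le)
  -- the buying cost is at least that of the optimal slope, so that `e ≤ j`
  have hej : r (h j) ≤ r (h e) := by
    have h4 : h e < h (j + 1) := by
      by_contra hn
      have h5 := C.b_le (not_lt.1 hn) (H.le_k I.e_le)
      have := mul_nonneg hre I.time_nonneg
      linarith
    have h5 : e ≤ j := by
      by_contra hn
      have := H.mono (show j + 1 ≤ e by omega) I.e_le
      omega
    exact C.r_le (H.mono h5 hj.le) (H.le_k hj.le)
  have h4 := gap_mul (c := c) (e := e) C H hj
  have h5 : 0 ≤ position b h j B :=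
    div_nonneg (by linarith [I.b_le]) (by linarith [H.b_succ C hj])
  have h6 := H.r_succ C hj
  rw [mul_add, h4]
  nlinarith

/-- Follow the flow until time `t₁`. -/
theorem PathInv.piece (C : Costs k b r) (H : IsHull k b r m h τ) (hc : 1 ≤ c)
    (I : PathInv k b r m h τ c D B j e) (hj : j < m) (hB : B < b (h (j + 1)))
    {X : ℝ} (hXdef : X = position b h j B + gap r h c j e) (hX : 0 ≤ X)
    {t₁ : ℝ} (ht : D.start D.size ≤ t₁) (he : e < m → t₁ ≤ τ e)
    (hend : flow b h τ j (gap r h c j e) X (D.start D.size) t₁ ≤ b (h (j + 1))) :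
    PathInv k b r m h τ c
      (D.push (h j) (h (j + 1)) (-gap r h c j e) (X * Real.exp ((0 - D.start D.size) / τ j))
        (1 / τ j) t₁)
      (flow b h τ j (gap r h c j e) X (D.start D.size) t₁) j e := by
  have ht0 := I.time_nonneg
  set t₀ := D.start D.size with ht₀
  set G := gap r h c j e with hG
  set Y := flow b h τ j G X t₀ with hY
  have hYmono : Monotone Y := flow_mono C H hj hX
  have hYc : Continuous Y := continuous_flow
  have hY0 : Y t₀ = B := by rw [hY, hXdef, flow_start C H hj]
  have hYd : ∀ s, HasDerivAt Y (c * r (h e) - edgeRate b r h τ j (Y s)) s := fun s =>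
    hasDerivAt_flow C H hj X t₀ s
  have hΔ := H.b_succ C hj
  have hτ := H.tau_pos C hj
  have hbk : b (h (j + 1)) ≤ b k := C.b_le (H.le_k hj) le_rfl
  have hsz : (D.push (h j) (h (j + 1)) (-G) (X * Real.exp ((0 - t₀) / τ j)) (1 / τ j) t₁).size =
    D.size + 1 := rfl
  have hstart : ∀ n, n ≤ D.size →
      (D.push (h j) (h (j + 1)) (-G) (X * Real.exp ((0 - t₀) / τ j)) (1 / τ j) t₁).start n =
        D.start n := fun n hn => Function.update_of_ne (by omega) _ _
  have hlast :
      (D.push (h j) (h (j + 1)) (-G) (X * Real.exp ((0 - t₀) / τ j)) (1 / τ j) t₁).start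
        (D.size + 1) = t₁ := Function.update_self _ _ _
  set D' := D.push (h j) (h (j + 1)) (-G) (X * Real.exp ((0 - t₀) / τ j)) (1 / τ j) t₁ with hD'
  rw [← hsz] at hlast
  refine ⟨I.j_le, I.e_le, ?_, ?_, ?_, ?_, ?_, ?_, ?_, ?_⟩
  · rw [hstart 0 (Nat.zero_le _), I.start_zero]
  · intro n hn
    rcases Nat.lt_or_ge n D.size with h1 | h1
    · rw [hstart n h1.le, hstart (n + 1) h1]; exact I.start_le n h1
    · obtain rfl : n = D.size := by omega
      rw [hstart _ le_rfl, ← hsz, hlast]; exact ht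
  · intro d hd
    rw [hlast]; exact (I.left d hd).trans ht
  · rw [hlast]; exact he
  · exact I.b_le.trans (hY0.symm.le.trans (hYmono ht))
  · intro h2
    rw [hlast]
    have h3 := I.two h2
    have hspeed : r (h e) ≤ (r (h j) - r (h (j + 1))) * X := hXdef ▸ I.speed_ge C H hj hB h2
    have hgrow : r (h e) * (t₁ - t₀) ≤ Y t₁ - Y t₀ := by
      have h4 : Y t₁ - Y t₀ =
          (b (h (j + 1)) - b (h j)) * X * (Real.exp ((t₁ - t₀) / τ j) - 1) := by
        simp only [hY, flow, sub_self, zero_div, Real.exp_zero]; ring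
      have h5 := Real.add_one_le_exp ((t₁ - t₀) / τ j)
      calc r (h e) * (t₁ - t₀) ≤ (r (h j) - r (h (j + 1))) * X * (t₁ - t₀) := by
            apply mul_le_mul_of_nonneg_right hspeed; linarith
        _ = (b (h (j + 1)) - b (h j)) * X * ((t₁ - t₀) / τ j) := by
            rw [← H.cross j hj]; field_simp
        _ ≤ _ := by
            rw [h4]
            apply mul_le_mul_of_nonneg_left (by linarith) (mul_nonneg (by linarith) hX)
    linarith
  · intro R S A
    rw [hlast]
    refine A.le_flow C H hj I.e_le hYd ht0 ht ?_
    rw [hY0]; exact I.lower R S A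
  · obtain ⟨f, hfc, hfm, hfe, hfle, hfeq, hfM⟩ := I.path
    have hminB : min B (b k) = B := min_eq_left (by linarith)
    rw [hminB] at hfe
    -- the new path: `f` before time `t₀`, then `Y`, and constant after time `t₁`
    set g : ℝ → ℝ := fun t => f t + (Y (max t₀ (min t₁ t)) - Y t₀) with hg
    have hg1 : ∀ t, t ≤ t₀ → g t = f t := by
      intro t h1
      have : max t₀ (min t₁ t) = t₀ := max_eq_left ((min_le_right _ _).trans h1)
      simp [hg, this]
    have hg2 : ∀ t, t₀ ≤ t → t ≤ t₁ → g t = Y t := by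
      intro t h1 h2
      have : max t₀ (min t₁ t) = t := by rw [min_eq_right h2, max_eq_right h1]
      simp [hg, this, hfe t h1, hY0]
    have hg3 : ∀ t, t₁ ≤ t → g t = Y t₁ := by
      intro t h1
      have : max t₀ (min t₁ t) = t₁ := by rw [min_eq_left h1, max_eq_right ht]
      simp [hg, this, hfe t (ht.trans h1), hY0]
    have hint1 : ∀ t, 0 ≤ t → t ≤ t₀ → ∫ z in (0 : ℝ)..t, hullRate b r m h τ (g z) =
        ∫ z in (0 : ℝ)..t, hullRate b r m h τ (f z) := by
      intro t h1 h2
      apply intervalIntegral.integral_congr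
      intro z hz
      rw [Set.uIcc_of_le h1] at hz
      simp only [hg1 z (hz.2.trans h2)]
    have hgc : Continuous g := by fun_prop
    have hφ : Continuous fun z => hullRate b r m h τ (g z) := continuous_hullRate.comp hgc
    have hYle : ∀ z, t₀ ≤ z → b (h j) ≤ Y z := fun z hz =>
      I.b_le.trans (hY0.symm.le.trans (hYmono hz))
    have hYge : ∀ z, z ≤ t₁ → Y z ≤ b (h (j + 1)) := fun z hz => (hYmono hz).trans hend
    have hint2 : ∀ t, t₀ ≤ t → t ≤ t₁ →
        g t + ∫ z in (0 : ℝ)..t, hullRate b r m h τ (g z) = c * (b (h e) + r (h e) * t) := by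
      intro t h1 h2
      have e1 : ∫ z in t₀..t, hullRate b r m h τ (g z) =
          ∫ z in t₀..t, (c * r (h e) - (c * r (h e) - edgeRate b r h τ j (Y z))) := by
        apply intervalIntegral.integral_congr
        intro z hz
        rw [Set.uIcc_of_le h1] at hz
        dsimp only
        rw [hg2 z hz.1 (hz.2.trans h2),
          hullRate_eq C H hj (hYle z hz.1) (hYge z (hz.2.trans h2))]
        ring
      have e2 : ∫ z in t₀..t, (c * r (h e) - (c * r (h e) - edgeRate b r h τ j (Y z))) =
          (c * r (h e) * t - Y t) - (c * r (h e) * t₀ - Y t₀) := by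
        apply intervalIntegral.integral_eq_sub_of_hasDerivAt
        · intro s _
          exact (((hasDerivAt_id s).const_mul (c * r (h e))).sub (hYd s)).congr_deriv (by simp)
        · have := continuous_edgeRate (b := b) (r := r) (h := h) (τ := τ) (j := j)
          exact Continuous.intervalIntegrable (by fun_prop) _ _
      have e3 := intervalIntegral.integral_add_adjacent_intervals
        (hφ.intervalIntegrable 0 t₀ : IntervalIntegrable _ volume _ _) (hφ.intervalIntegrable t₀ t)
      rw [← e3, hint1 t₀ ht0 le_rfl, hg2 t h1 h2, e1, e2, hY0]
      linarith
    refine ⟨g, hgc, ?_, ?_, ?_, ?_, ?_⟩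
    · apply hfm.add
      intro s t hst
      exact sub_le_sub_right (hYmono (max_le_max le_rfl (min_le_min le_rfl hst))) _
    · intro t h1
      rw [hlast] at h1
      rw [hg3 t h1, min_eq_left (hend.trans hbk)]
    · intro t h1 h2 i hi
      rw [hlast] at h2
      rcases le_total t t₀ with h3 | h3
      · rw [hg1 t h3, hint1 t h1 h3]; exact hfle t h1 h3 i hi
      · rw [hint2 t h3 h2]
        have := H.opt_le C I.e_le h1 (fun d hd => (I.left d hd).trans h3)
          (fun h4 => h2.trans (he h4)) hi
        exact mul_le_mul_of_nonneg_left this (by linarith)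
    · rw [hlast, ← hint2 t₁ ht le_rfl, hg3 t₁ le_rfl]
    · intro n hn t h1 h2
      rcases Nat.lt_or_ge n D.size with h3 | h3
      · rw [hstart n h3.le] at h1
        rw [hstart (n + 1) h3] at h2
        have h4 : t ≤ t₀ := by
          refine h2.trans ?_
          have : ∀ d, n + 1 + d ≤ D.size → D.start (n + 1) ≤ D.start (n + 1 + d) := by
            intro d
            induction d with
            | zero => intro _; rfl
            | succ d ih => exact fun h5 => (ih (by omega)).trans (I.start_le _ (by omega))
          obtain ⟨d, hd⟩ := Nat.exists_eq_add_of_le (show n + 1 ≤ D.size from h3)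
          have h5 := this d hd.ge
          rw [← hd] at h5
          exact h5
        rw [hg1 t h4]
        exact (hfM n h3 t h1 h2).push_of_lt h3 _ _ _ _ _ _
      · obtain rfl : n = D.size := by omega
        rw [hstart _ le_rfl] at h1
        rw [← hsz, hlast] at h2
        rw [hg2 t h1 h2]
        refine ⟨j, hj, Function.update_self _ _ _, Function.update_self _ _ _, hYle t h1,
          hYge t h2, ?_⟩
        have e1 : D'.const D.size + D'.coef D.size * Real.exp (D'.rate D.size * t) =
            -G + X * Real.exp ((t - t₀) / τ j) := by
          simp only [hD', Description.push, Function.update_self]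
          rw [mul_assoc, ← Real.exp_add]
          congr 3
          ring
        rw [e1]
        simp only [hY, flow]
        ring

/-- The last piece, during which the probabilities do not change. -/
theorem PathInv.finish (C : Costs k b r) (H : IsHull k b r m h τ) (hc : 0 ≤ c)
    (I : PathInv k b r m h τ c D B j e) {l : ℕ} (hl : l < m)
    (h1 : b (h l) ≤ min B (b k)) (h2 : min B (b k) ≤ b (h (l + 1)))
    {A Γ α t₁ : ℝ} (hA : ∀ t, (b (h (l + 1)) - b (h l)) * (A + Γ * Real.exp (α * t)) =
      min B (b k) - b (h l))
    (hrate : ∀ i, i ≤ k → edgeRate b r h τ l (min B (b k)) ≤ c * r i) :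
    Solves k b r m h τ c (D.push (h l) (h (l + 1)) A Γ α t₁) := by
  have ht0 := I.time_nonneg
  obtain ⟨f, hfc, hfm, hfe, hfle, hfeq, hfM⟩ := I.path
  have hstart : ∀ n, n ≤ D.size →
      (D.push (h l) (h (l + 1)) A Γ α t₁).start n = D.start n := fun n hn =>
    Function.update_of_ne (by omega) _ _
  have hsz : (D.push (h l) (h (l + 1)) A Γ α t₁).size = D.size + 1 := rfl
  refine ⟨Nat.succ_pos _, ?_, ?_, f, hfc, hfm, ?_, ?_⟩
  · rw [hstart 0 (Nat.zero_le _), I.start_zero]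
  · intro n hn
    rw [hstart n (by omega), hstart (n + 1) (by omega)]
    exact I.start_le n (by omega)
  · intro t ht i hi
    rcases le_total t (D.start D.size) with h3 | h3
    · exact hfle t ht h3 i hi
    · have hφ : Continuous fun z => hullRate b r m h τ (f z) := continuous_hullRate.comp hfc
      have e1 := intervalIntegral.integral_add_adjacent_intervals
        (hφ.intervalIntegrable 0 (D.start D.size) : IntervalIntegrable _ volume _ _)
        (hφ.intervalIntegrable (D.start D.size) t)
      have e2 : ∫ z in D.start D.size..t, hullRate b r m h τ (f z) =
          ∫ z in D.start D.size..t, edgeRate b r h τ l (min B (b k)) := by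
        apply intervalIntegral.integral_congr
        intro z hz
        rw [Set.uIcc_of_le h3] at hz
        dsimp only
        rw [hfe z hz.1, hullRate_eq C H hl h1 h2]
      rw [intervalIntegral.integral_const, smul_eq_mul] at e2
      rw [← e1, e2, hfe t h3]
      have e3 := mul_le_mul_of_nonneg_left (hrate i hi) (sub_nonneg.2 h3)
      have e4 := mul_le_mul_of_nonneg_left (H.opt_le C I.e_le ht0 I.left I.right hi) hc
      have e5 := min_le_left B (b k)
      linarith
  · intro n hn t h3 h4
    rcases Nat.lt_or_ge n D.size with h5 | h5
    · rw [hstart n h5.le] at h3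
      have h6 := h4 (by omega)
      rw [hstart (n + 1) h5] at h6
      exact (hfM n h5 t h3 h6).push_of_lt h5 _ _ _ _ _ _
    · obtain rfl : n = D.size := by omega
      rw [hstart _ le_rfl] at h3
      refine ⟨l, hl, Function.update_self _ _ _, Function.update_self _ _ _, ?_, ?_, ?_⟩
      · rw [hfe t h3]; exact h1
      · rw [hfe t h3]; exact h2
      · rw [hfe t h3]
        simp only [Description.push, Function.update_self]
        exact hA t

/-- All probability has moved to slope `k`. -/
theorem PathInv.finish_last (C : Costs k b r) (H : IsHull k b r m h τ) (hm : 0 < m) (hc : 1 ≤ c)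
    (I : PathInv k b r m h τ c D B m e) (t₁ : ℝ) :
    Solves k b r m h τ c (D.push (h (m - 1)) (h m) 1 0 0 t₁) := by
  obtain ⟨n, rfl⟩ : ∃ n, m = n + 1 := ⟨m - 1, by omega⟩
  have hB := I.b_le
  have hlast := H.last
  have hmin : min B (b k) = b (h (n + 1)) := by
    rw [hlast] at hB ⊢; exact min_eq_right hB
  refine I.finish C H (by linarith) (Nat.lt_succ_self n) ?_ hmin.le ?_ ?_
  · rw [hmin]; exact (H.b_succ C (Nat.lt_succ_self n)).le
  · intro t; rw [hmin]; ring
  · intro i hi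
    have h1 := edgeRate_eq C H (Nat.lt_succ_self n) 1
    rw [mul_one, add_sub_cancel, mul_one, sub_sub_cancel] at h1
    rw [hmin, h1, hlast]
    have h2 : r k ≤ r i := C.r_le hi le_rfl
    have h3 := C.r_nonneg i hi
    nlinarith

/-- The strategy spends nothing on buying any more, and pays the rent rate `c * r k`. -/
theorem PathInv.finish_stationary (C : Costs k b r) (H : IsHull k b r m h τ) (hc : 1 ≤ c)
    (I : PathInv k b r m h τ c D B j m) (hj : j < m) (hB : B < b (h (j + 1))) {X : ℝ}
    (hXdef : X = position b h j B + gap r h c j m) (hX : X = 0) (Γ' α t₁ : ℝ) :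
    Solves k b r m h τ c
      (D.push (h j) (h (j + 1)) (-gap r h c j m) (X * Γ') α t₁) := by
  have hbk : b (h (j + 1)) ≤ b k := C.b_le (H.le_k hj) le_rfl
  have hmin : min B (b k) = B := min_eq_left (by linarith)
  have hpos := position_mul C H hj B
  have hq : position b h j B = -gap r h c j m := by linarith
  have h1 := edgeRate_eq C H hj (position b h j B)
  rw [hpos, add_sub_cancel, hq] at h1
  refine I.finish C H (by linarith) hj ?_ ?_ ?_ ?_ <;> rw [hmin]
  · exact I.b_le
  · exact hB.le
  · intro t
    rw [hX, ← hpos, hq]; ring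
  · intro i hi
    have h4 := gap_mul (c := c) (e := m) C H hj
    have h2 : r k ≤ r i := C.r_le hi le_rfl
    rw [H.last] at h4
    have : c * r k ≤ c * r i := mul_le_mul_of_nonneg_left h2 (by linarith)
    linarith

/-- If the buying cost would have to decrease, then there is no competitor. -/
theorem PathInv.no_competitor (C : Costs k b r) (H : IsHull k b r m h τ)
    (I : PathInv k b r m h τ c D B j e) (hj : j < m)
    (hX : position b h j B + gap r h c j e < 0) (R S : ℝ → ℝ) :
    ¬ Competitor k b r m h τ c R S := fun A =>
  absurd (A.nonneg_of_le C H hj I.e_le I.time_nonneg (I.lower R S A)) (not_le.2 hX)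

theorem PathInv.lt_two (C : Costs k b r) (H : IsHull k b r m h τ)
    (I : PathInv k b r m h τ c D B j e) (hj : j < m) (hB : B < b (h (j + 1)))
    (hX : position b h j B + gap r h c j e < 0) : c < 2 := by
  by_contra hn
  have h1 := I.speed_ge C H hj hB (not_lt.1 hn)
  have h2 := C.r_nonneg _ (H.le_k I.e_le)
  have h3 := H.r_succ C hj
  nlinarith

end

end SkiRental

/-! ### The profile of a randomized strategy -/

namespace SkiRental

section
variable {k : ℕ}

theorem Times.slope_mono (T : Times k) : Monotone T.slope := by
  intro s t hst
  refine Fin.mk_le_mk.2 (Finset.card_le_card fun j hj => ?_)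
  simp only [Finset.mem_filter, Finset.mem_univ, true_and] at hj ⊢
  exact hj.trans (ENNReal.ofReal_le_ofReal hst)

theorem measurable_slope (t : ℝ) : Measurable fun T : Times k => T.slope t := by
  have h1 : Measurable fun T : Times k =>
      ∑ j : Fin k, if T j ≤ ENNReal.ofReal t then (1 : ℕ) else 0 :=
    Finset.measurable_sum _ fun j _ => Measurable.ite
      (measurableSet_le (measurable_pi_apply j) measurable_const) measurable_const measurable_const
  refine measurable_to_countable' fun i => ?_
  convert h1 (MeasurableSet.singleton (i : ℕ)) using 1
  ext T
  simp only [Set.mem_preimage, Set.mem_singleton_iff, Times.slope, Fin.ext_iff, Finset.card_filter]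

theorem sum_profileOf (μ : Measure (Times k)) [IsProbabilityMeasure μ] (t : ℝ)
    (φ : Fin (k + 1) → ℝ) : ∑ i, profileOf μ t i * φ i = ∫ T, φ (T.slope t) ∂μ := by
  have hm := measurable_slope (k := k) t
  have := Measure.isProbabilityMeasure_map (μ := μ) hm.aemeasurable
  rw [← integral_map (f := φ) hm.aemeasurable (Measurable.of_discrete).aestronglyMeasurable,
    integral_fintype Integrable.of_finite]
  refine Finset.sum_congr rfl fun i _ => ?_
  rw [map_measureReal_apply hm (MeasurableSet.singleton i), smul_eq_mul]
  rfl

theorem integrable_slope (μ : Measure (Times k)) [IsProbabilityMeasure μ] (t : ℝ)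
    (φ : Fin (k + 1) → ℝ) : Integrable (fun T : Times k => φ (T.slope t)) μ := by
  have hm := measurable_slope (k := k) t
  have := Measure.isProbabilityMeasure_map (μ := μ) hm.aemeasurable
  exact (Integrable.of_finite (μ := μ.map fun T => T.slope t) (f := φ)).comp_measurable hm

/-! ### The strategy of a profile -/

/-- The probability that the slope is at least `i`. -/
def tailSum (p : Fin (k + 1) → ℝ) (i : ℕ) : ℝ :=
  ∑ l ∈ Finset.univ.filter fun l : Fin (k + 1) => i ≤ (l : ℕ), p l

theorem sum_Ici_succ (p : Fin (k + 1) → ℝ) (j : Fin k) :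
    ∑ i ∈ Finset.Ici j.succ, p i = tailSum p (j + 1) := by
  refine Finset.sum_congr ?_ fun _ _ => rfl
  ext l
  simp [Fin.le_def]

theorem tailSum_zero (p : Fin (k + 1) → ℝ) : tailSum p 0 = ∑ i, p i := by
  simp [tailSum]

theorem tailSum_last (p : Fin (k + 1) → ℝ) : tailSum p (k + 1) = 0 := by
  apply Finset.sum_eq_zero
  intro l hl
  have := (Finset.mem_filter.1 hl).2
  omega

theorem tailSum_eq_add (p : Fin (k + 1) → ℝ) (i : Fin (k + 1)) :
    tailSum p i = p i + tailSum p (i + 1) := by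
  have h1 : (Finset.univ.filter fun l : Fin (k + 1) => (i : ℕ) ≤ l) =
      insert i (Finset.univ.filter fun l : Fin (k + 1) => (i : ℕ) + 1 ≤ l) := by
    ext l
    simp only [Finset.mem_filter, Finset.mem_univ, true_and, Finset.mem_insert, Fin.ext_iff]
    omega
  rw [tailSum, h1, Finset.sum_insert (by simp)]
  rfl

theorem tailSum_antitone {p : Fin (k + 1) → ℝ} (hp : ∀ i, 0 ≤ p i) : Antitone (tailSum p) := by
  intro i j hij
  refine Finset.sum_le_sum_of_subset_of_nonneg (fun l hl => ?_) fun i _ _ => hp i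
  simp only [Finset.mem_filter, Finset.mem_univ, true_and] at hl ⊢
  omega

/-- An antitone sequence `g` reaches the level `u` at the positions `0, …, i` if and only if it
reaches it at `i` positions among `1, …, k`. -/
theorem card_filter_le_eq_iff {g : ℕ → ℝ} (hg : Antitone g) {u : ℝ} (h0 : u ≤ g 0)
    (hk : g (k + 1) < u) (i : ℕ) :
    (Finset.univ.filter fun j : Fin k => u ≤ g (j + 1)).card = i ↔ g (i + 1) < u ∧ u ≤ g i := by
  have key : ∀ i, g (i + 1) < u → u ≤ g i →
      (Finset.univ.filter fun j : Fin k => u ≤ g (j + 1)).card = i := by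
    intro i h1 h2
    have hik : i ≤ k := by
      by_contra hn
      exact absurd (h2.trans (hg (show k + 1 ≤ i by omega))) (not_le.2 hk)
    have h3 : (Finset.univ.filter fun j : Fin k => u ≤ g (j + 1)) =
        Finset.univ.filter fun j : Fin k => (j : ℕ) < i := by
      ext j
      simp only [Finset.mem_filter, Finset.mem_univ, true_and]
      constructor
      · intro h4
        by_contra hn
        exact absurd (h4.trans (hg (show i + 1 ≤ (j : ℕ) + 1 by omega))) (not_le.2 h1)
      · intro h4
        exact h2.trans (hg h4)
    rw [h3, Fin.card_filter_val_lt, min_eq_right hik]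
  refine ⟨?_, fun h => key i h.1 h.2⟩
  rintro rfl
  classical
  have hex : ∃ n, g (n + 1) < u := ⟨k, hk⟩
  have h1 := Nat.find_spec hex
  have h2 : u ≤ g (Nat.find hex) := by
    rcases hn : Nat.find hex with _ | n
    · exact h0
    · exact not_lt.1 (Nat.find_min hex (show n < Nat.find hex by omega))
  rw [key _ h1 h2]
  exact ⟨h1, h2⟩

/-- The requirements on a profile for being that of a randomized strategy. -/
structure IsProfile (p : Profile k) : Prop where
  nonneg : ∀ t, 0 ≤ t → ∀ i, 0 ≤ p t i
  sum_eq : ∀ t, 0 ≤ t → ∑ i, p t i = 1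
  mono : ∀ i, i < k → MonotoneOn (fun t => tailSum (p t) (i + 1)) (Set.Ici 0)
  cont : ∀ i, i < k → ContinuousOn (fun t => tailSum (p t) (i + 1)) (Set.Ici 0)

/-- The transition times of the strategy of a profile `p` for the outcome `u`. -/
def timesOf (p : Profile k) (u : ℝ) : Times k := fun j =>
  sInf (ENNReal.ofReal '' {t : ℝ | 0 ≤ t ∧ u ≤ tailSum (p t) (j + 1)})

theorem strategyOf_eq (p : Profile k) :
    strategyOf p = (volume.restrict (Set.Icc (0 : ℝ) 1)).map (timesOf p) := by
  unfold strategyOf timesOf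
  simp only [sum_Ici_succ]

theorem measurable_timesOf (p : Profile k) : Measurable (timesOf p) := by
  refine measurable_pi_lambda _ fun j => Monotone.measurable fun u v huv => ?_
  exact sInf_le_sInf (Set.image_mono fun t ht => ⟨ht.1, huv.trans ht.2⟩)

/-- The first time at which the level `u` is reached is at most `t` if and only if `u` is reached at
time `t`, because the probability to be in a slope after `j` is continuous and never decreases. -/
theorem IsProfile.timesOf_le_iff {p : Profile k} (hp : IsProfile p) {t : ℝ} (ht : 0 ≤ t) (u : ℝ)
    (j : Fin k) : timesOf p u j ≤ ENNReal.ofReal t ↔ u ≤ tailSum (p t) (j + 1) := by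
  constructor
  · intro hle
    by_contra hn
    push Not at hn
    -- by right continuity the level `u` is not reached before some time `s > t`
    have h1 : ∀ᶠ s in nhdsWithin t (Set.Ici 0), tailSum (p s) (j + 1) < u :=
      (hp.cont j j.2 t ht).eventually_lt_const hn
    have h2 : nhdsWithin t (Set.Ioi t) ≤ nhdsWithin t (Set.Ici 0) :=
      nhdsWithin_mono _ fun s hs => ht.trans (le_of_lt hs)
    obtain ⟨s, hs, hts⟩ := ((h1.filter_mono h2).and self_mem_nhdsWithin).exists
    have hts : t < s := hts
    have h3 : ENNReal.ofReal s ≤ timesOf p u j := by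
      apply le_sInf
      rintro _ ⟨z, ⟨hz, huz⟩, rfl⟩
      apply ENNReal.ofReal_le_ofReal
      by_contra hzs
      have := hp.mono j j.2 hz (ht.trans hts.le : (0 : ℝ) ≤ s) (not_le.1 hzs).le
      simp only at this
      linarith
    have h4 := (ENNReal.ofReal_le_ofReal_iff ht).1 (h3.trans hle)
    linarith
  · intro hu
    exact sInf_le ⟨t, ⟨ht, hu⟩, rfl⟩

theorem IsProfile.timesOf_mono {p : Profile k} (hp : IsProfile p) (u : ℝ) :
    Monotone (timesOf p u) := by
  intro i j hij
  refine sInf_le_sInf (Set.image_mono fun t ht => ⟨ht.1, ht.2.trans ?_⟩)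
  exact tailSum_antitone (hp.nonneg t ht.1) (Nat.succ_le_succ hij)

theorem IsProfile.isStrategy {p : Profile k} (hp : IsProfile p) : IsStrategy (strategyOf p) := by
  have hm := measurable_timesOf p
  rw [strategyOf_eq]
  refine ⟨?_, ?_⟩
  · have : IsProbabilityMeasure (volume.restrict (Set.Icc (0 : ℝ) 1)) := ⟨by simp⟩
    exact Measure.isProbabilityMeasure_map hm.aemeasurable
  · have hset : MeasurableSet {T : Times k | Monotone T} := by
      have : {T : Times k | Monotone T} = ⋂ i, ⋂ j, ⋂ _ : i ≤ j, {T | T i ≤ T j} := by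
        ext T; simp [Monotone]
      rw [this]
      exact MeasurableSet.iInter fun i => MeasurableSet.iInter fun j => MeasurableSet.iInter
        fun _ => measurableSet_le (measurable_pi_apply i) (measurable_pi_apply j)
    exact (ae_map_iff hm.aemeasurable hset).2 (ae_of_all _ hp.timesOf_mono)

theorem IsProfile.profileOf_strategyOf {p : Profile k} (hp : IsProfile p) {t : ℝ} (ht : 0 ≤ t) :
    profileOf (strategyOf p) t = p t := by
  funext i
  have hanti := tailSum_antitone (hp.nonneg t ht)
  have hzero : tailSum (p t) 0 = 1 := (tailSum_zero _).trans (hp.sum_eq t ht)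
  have hlast := tailSum_last (p t)
  have hset : {u | (timesOf p u).slope t = i} ∩ Set.Ioc 0 1 =
      Set.Ioc (tailSum (p t) (i + 1)) (tailSum (p t) i) := by
    ext u
    have h1 : 0 < u → u ≤ 1 → ((timesOf p u).slope t = i ↔
        tailSum (p t) (i + 1) < u ∧ u ≤ tailSum (p t) i) := by
      intro h1 h2
      rw [← card_filter_le_eq_iff (k := k) hanti (by rwa [hzero]) (by rwa [hlast]), Times.slope,
        Fin.ext_iff]
      simp only [hp.timesOf_le_iff ht]
    simp only [Set.mem_inter_iff, Set.mem_ofPred_eq, Set.mem_Ioc]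
    constructor
    · rintro ⟨h2, h3, h4⟩
      exact (h1 h3 h4).1 h2
    · intro h2
      have h3 : 0 < u := (hlast.ge.trans (hanti (by omega))).trans_lt h2.1
      have h4 : u ≤ 1 := h2.2.trans ((hanti (Nat.zero_le _)).trans hzero.le)
      exact ⟨(h1 h3 h4).2 h2, h3, h4⟩
  have hms : MeasurableSet {T : Times k | T.slope t = i} :=
    measurable_slope t (MeasurableSet.singleton i)
  rw [profileOf, strategyOf_eq, map_measureReal_apply (measurable_timesOf p) hms,
    ← restrict_Ioc_eq_restrict_Icc, measureReal_restrict_apply (measurable_timesOf p hms)]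
  rw [show timesOf p ⁻¹' {T | T.slope t = i} = {u | (timesOf p u).slope t = i} from rfl, hset,
    Real.volume_real_Ioc_of_le (hanti (Nat.le_succ _)), tailSum_eq_add]
  ring

end

end SkiRental

/-! ### Competitive strategies and the hull -/

namespace SkiRental

section
variable {k m j : ℕ} {h : ℕ → ℕ} {τ : ℕ → ℝ} {c : ℝ} {D : Description}

/-- The buying costs as a sequence on all natural numbers, extended by `0`. -/
def Instance.bSeq (M : Instance k) (i : ℕ) : ℝ := if h : i < k + 1 then M.b ⟨i, h⟩ else 0

/-- The rental rates as a sequence on all natural numbers, extended by `0`. -/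
def Instance.rSeq (M : Instance k) (i : ℕ) : ℝ := if h : i < k + 1 then M.r ⟨i, h⟩ else 0

theorem Instance.bSeq_val (M : Instance k) (i : Fin (k + 1)) : M.bSeq i = M.b i := dif_pos i.2

theorem Instance.rSeq_val (M : Instance k) (i : Fin (k + 1)) : M.rSeq i = M.r i := dif_pos i.2

theorem Instance.costs (M : Instance k) : Costs k M.bSeq M.rSeq where
  b_lt {i j} hij hj := by
    rw [M.bSeq_val ⟨i, by omega⟩, M.bSeq_val ⟨j, by omega⟩]
    exact M.b_strictMono hij
  r_lt {i j} hij hj := by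
    rw [M.rSeq_val ⟨i, by omega⟩, M.rSeq_val ⟨j, by omega⟩]
    exact M.r_strictAnti hij
  b_nonneg i hi := by
    rw [M.bSeq_val ⟨i, by omega⟩]
    exact M.b_nonneg _
  r_nonneg i hi := by
    rw [M.rSeq_val ⟨i, by omega⟩]
    exact M.r_nonneg _

theorem Instance.opt_le (M : Instance k) (t : ℝ) (i : Fin (k + 1)) :
    M.opt t ≤ M.b i + M.r i * t := ciInf_le (Set.finite_range _).bddBelow i

theorem Instance.opt_nonneg (M : Instance k) {t : ℝ} (ht : 0 ≤ t) : 0 ≤ M.opt t :=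
  le_ciInf fun i => add_nonneg (M.b_nonneg i) (mul_nonneg (M.r_nonneg i) ht)

theorem IsCompetitive.mono {M : Instance k} {μ : Measure (Times k)} {c c' : ℝ}
    (hμ : IsCompetitive M μ c) (hc : c ≤ c') : IsCompetitive M μ c' := fun t ht =>
  (hμ t ht).trans (mul_le_mul_of_nonneg_right hc (M.opt_nonneg ht))

/-- The rent rate of a strategy never increases, so that it is integrable; and by Jensen's
inequality no line through an edge of the hull exceeds it. -/
theorem IsCompetitive.competitor {M : Instance k} {μ : Measure (Times k)} (hμ : IsStrategy μ)
    (hc0 : 0 ≤ c) (hc : IsCompetitive M μ c) (H : IsHull k M.bSeq M.rSeq m h τ) :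
    Competitor k M.bSeq M.rSeq m h τ c (M.rentRate (profileOf μ)) (M.buyCost (profileOf μ)) := by
  have := hμ.isProbabilityMeasure
  have hR : ∀ t, M.rentRate (profileOf μ) t = ∫ T, M.r (T.slope t) ∂μ := fun t =>
    sum_profileOf μ t M.r
  have hB : ∀ t, M.buyCost (profileOf μ) t = ∫ T, M.b (T.slope t) ∂μ := fun t =>
    sum_profileOf μ t M.b
  refine ⟨?_, ?_, ?_, ?_⟩
  · have hanti : Antitone (M.rentRate (profileOf μ)) := by
      intro s t hst
      rw [hR, hR]
      exact integral_mono (integrable_slope μ t M.r) (integrable_slope μ s M.r) fun T =>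
        M.r_strictAnti.antitone (T.slope_mono hst)
    exact fun s t => hanti.intervalIntegrable
  · intro j hj t
    have h1 : edgeRate M.bSeq M.rSeq h τ j (M.buyCost (profileOf μ) t) =
        ∫ T, edgeRate M.bSeq M.rSeq h τ j (M.b (T.slope t)) ∂μ := by
      simp only [edgeRate, hB]
      rw [integral_sub (integrable_const _)
        (integrable_slope μ t fun i => (M.b i - M.bSeq (h j)) / τ j),
        integral_div, integral_sub (integrable_slope μ t M.b) (integrable_const _)]
      simp
    rw [h1, hR]
    refine integral_mono (integrable_slope μ t fun i => edgeRate M.bSeq M.rSeq h τ j (M.b i))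
      (integrable_slope μ t M.r) fun T => ?_
    have h2 := edgeRate_apply_le M.costs H hj (Nat.lt_succ_iff.1 (T.slope t).2)
    rwa [M.bSeq_val, M.rSeq_val] at h2
  · intro t
    have h1 : M.bSeq 0 = ∫ _, M.b 0 ∂μ := by
      simpa using M.bSeq_val 0
    rw [h1, hB]
    exact integral_mono (integrable_const _) (integrable_slope μ t M.b) fun T =>
      M.b_strictMono.monotone (Fin.zero_le _)
  · intro t ht i hi
    rw [M.bSeq_val ⟨i, by omega⟩, M.rSeq_val ⟨i, by omega⟩]
    exact (hc t ht).trans (mul_le_mul_of_nonneg_left (M.opt_le t _) hc0)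

theorem Instance.achievable_nonneg (M : Instance k) (hk : 1 ≤ k) {c : ℝ}
    (hc : c ∈ M.achievable) : 0 ≤ c := by
  obtain ⟨μ, hμ, hcomp⟩ := hc
  have := hμ.isProbabilityMeasure
  by_contra hn
  push Not at hn
  have h1 := hcomp 1 zero_le_one
  have hpos : 0 < M.opt 1 := by
    obtain ⟨i, hi⟩ := exists_eq_ciInf_of_finite (f := fun i => M.b i + M.r i * 1)
    rw [Instance.opt, ← hi]
    rcases eq_or_ne i 0 with rfl | h0
    · have h2 := M.r_strictAnti (show (0 : Fin (k + 1)) < ⟨k, Nat.lt_succ_self k⟩ from hk)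
      have := M.r_nonneg ⟨k, Nat.lt_succ_self k⟩
      have := M.b_nonneg 0
      linarith
    · have h2 := M.b_strictMono (Fin.pos_iff_ne_zero.2 h0)
      have := M.r_nonneg i
      have := M.b_nonneg 0
      linarith
  have hp : ∀ t i, 0 ≤ profileOf μ t i := fun t i => measureReal_nonneg
  have h2 : 0 ≤ M.totalCost (profileOf μ) 1 := by
    refine add_nonneg (Finset.sum_nonneg fun i _ => mul_nonneg (hp _ i) (M.b_nonneg i)) ?_
    exact intervalIntegral.integral_nonneg zero_le_one fun t _ =>
      Finset.sum_nonneg fun i _ => mul_nonneg (hp _ i) (M.r_nonneg i)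
  nlinarith

/-- No competitive factor is smaller than `1`. -/
theorem Competitor.one_le {b r : ℕ → ℝ} {R S : ℝ → ℝ} (A : Competitor k b r m h τ c R S)
    (C : Costs k b r) (H : IsHull k b r m h τ) (hm : 0 < m) : 1 ≤ c := by
  have h1 := A.nonneg_of_le C H hm (Nat.zero_le m) le_rfl (B := c * b 0) (by simp [H.zero])
  by_contra hn
  push Not at hn
  have h2 := H.b_succ C hm
  have h3 := H.r_succ C hm
  have h4 := C.r_nonneg _ (H.le_k hm)
  have h5 : position b h 0 (c * b 0) ≤ 0 := by
    refine div_nonpos_of_nonpos_of_nonneg ?_ (by linarith)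
    rw [H.zero]
    nlinarith [C.b_nonneg 0 (Nat.zero_le k)]
  have h6 : gap r h c 0 0 < 0 := by
    refine div_neg_of_neg_of_pos ?_ (by linarith)
    nlinarith
  linarith

theorem IsHull.exists_edge {b r : ℕ → ℝ} (H : IsHull k b r m h τ) {i : ℕ} (hi : i < k) :
    ∃ j, j < m ∧ h j ≤ i ∧ i < h (j + 1) := by
  have key : ∀ n, n ≤ m → i < h n → ∃ j, j < n ∧ h j ≤ i ∧ i < h (j + 1) := by
    intro n
    induction n with
    | zero => intro _ h0; rw [H.zero] at h0; omega
    | succ n ih =>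
      intro hn hlt
      rcases Nat.lt_or_ge i (h n) with h1 | h1
      · obtain ⟨j, hj, hj'⟩ := ih (by omega) h1
        exact ⟨j, by omega, hj'⟩
      · exact ⟨n, by omega, h1, hlt⟩
  exact key m le_rfl (by rw [H.last]; exact hi)

theorem Description.pieceAt_spec {k : ℕ} {b r : ℕ → ℝ} (S : Solves k b r m h τ c D) {t : ℝ}
    (ht : 0 ≤ t) : D.pieceAt t < D.size ∧ D.start (D.pieceAt t) ≤ t ∧
      (D.pieceAt t + 1 < D.size → t ≤ D.start (D.pieceAt t + 1)) := by
  set s := (Finset.range D.size).filter fun n => D.start n ≤ t with hs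
  have hne : s.Nonempty :=
    ⟨0, Finset.mem_filter.2 ⟨Finset.mem_range.2 S.size_pos, by rwa [S.start_zero]⟩⟩
  obtain ⟨n, hn, hn'⟩ := Finset.exists_mem_eq_sup s hne id
  have hpiece : D.pieceAt t = n := hn'
  rw [hpiece]
  have h1 := Finset.mem_filter.1 hn
  refine ⟨Finset.mem_range.1 h1.1, h1.2, fun h2 => ?_⟩
  by_contra h3
  have h4 : n + 1 ∈ s := Finset.mem_filter.2 ⟨Finset.mem_range.2 h2, (not_le.1 h3).le⟩
  have h5 : n + 1 ≤ D.pieceAt t := Finset.le_sup (f := id) h4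
  omega

theorem sum_ite_val {s : Finset (Fin (k + 1))} {a : ℕ} (ha : a ≤ k) (q : ℝ)
    (φ : Fin (k + 1) → ℝ) : ∑ i ∈ s, (if (i : ℕ) = a then q else 0) * φ i =
      if (⟨a, by omega⟩ : Fin (k + 1)) ∈ s then q * φ ⟨a, by omega⟩ else 0 := by
  have : ∀ i : Fin (k + 1), (if (i : ℕ) = a then q else 0) * φ i =
      if i = ⟨a, by omega⟩ then q * φ i else 0 := by
    intro i
    simp only [Fin.ext_iff, ite_mul, zero_mul]
  simp only [this, Finset.sum_ite_eq']

/-- At each time, the probability is distributed between the ends of the edge of the hull on which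
the expected buying cost lies, and `q` is the probability at the upper end. -/
theorem Solves.exists_mix {b r : ℕ → ℝ} (C : Costs k b r) (H : IsHull k b r m h τ)
    (S : Solves k b r m h τ c D) {f : ℝ → ℝ}
    (hf : ∀ n, n < D.size → ∀ t, D.start n ≤ t → (n + 1 < D.size → t ≤ D.start (n + 1)) →
      Matches b m h D n t (f t)) {t : ℝ} (ht : 0 ≤ t) :
    ∃ j q, j < m ∧ 0 ≤ q ∧ q ≤ 1 ∧ f t = b (h j) + (b (h (j + 1)) - b (h j)) * q ∧
      D.profile k t = fun i : Fin (k + 1) =>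
        (if (i : ℕ) = h (j + 1) then q else 0) + (if (i : ℕ) = h j then 1 - q else 0) := by
  obtain ⟨h1, h2, h3⟩ := Description.pieceAt_spec S ht
  obtain ⟨j, hj, hl, hu, h4, h5, h6⟩ := hf _ h1 t h2 h3
  have hb := H.b_succ C hj
  refine ⟨j, _, hj, ?_, ?_, (sub_eq_iff_eq_add'.1 h6.symm), ?_⟩
  · by_contra hn; nlinarith
  · by_contra hn; nlinarith
  · funext i
    simp only [Description.profile, hl, hu]

theorem sum_mix {p : Fin (k + 1) → ℝ} {l u : ℕ} (hl : l ≤ k) (hu : u ≤ k) {q : ℝ}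
    (hp : p = fun i : Fin (k + 1) =>
      (if (i : ℕ) = u then q else 0) + (if (i : ℕ) = l then 1 - q else 0))
    (φ : Fin (k + 1) → ℝ) :
    ∑ i, p i * φ i = q * φ ⟨u, by omega⟩ + (1 - q) * φ ⟨l, by omega⟩ := by
  simp only [hp, add_mul, Finset.sum_add_distrib, sum_ite_val hl, sum_ite_val hu,
    Finset.mem_univ, if_true]

theorem tailSum_mix {p : Fin (k + 1) → ℝ} {l u : ℕ} (hl : l ≤ k) (hu : u ≤ k) {q : ℝ}
    (hp : p = fun i : Fin (k + 1) =>
      (if (i : ℕ) = u then q else 0) + (if (i : ℕ) = l then 1 - q else 0))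
    (i : ℕ) : tailSum p i = (if i ≤ u then q else 0) + if i ≤ l then 1 - q else 0 := by
  have h1 := sum_ite_val (s := Finset.univ.filter fun l : Fin (k + 1) => i ≤ (l : ℕ)) hl (1 - q)
    fun _ => 1
  have h2 := sum_ite_val (s := Finset.univ.filter fun l : Fin (k + 1) => i ≤ (l : ℕ)) hu q
    fun _ => 1
  simp only [mul_one, Finset.mem_filter, Finset.mem_univ, true_and] at h1 h2
  simp only [tailSum, hp, Finset.sum_add_distrib, h1, h2]

/-- The probability to have passed a slope inside an edge is the position on that edge, cut off at
`0` and `1`. In particular it never decreases, like the expected buying cost. -/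
theorem tailSum_mix_eq {b r : ℕ → ℝ} (C : Costs k b r) (H : IsHull k b r m h τ)
    {p : Fin (k + 1) → ℝ} (hj : j < m) {q x : ℝ} (hq0 : 0 ≤ q) (hq1 : q ≤ 1)
    (hx : x = b (h j) + (b (h (j + 1)) - b (h j)) * q)
    (hp : p = fun i : Fin (k + 1) =>
      (if (i : ℕ) = h (j + 1) then q else 0) + (if (i : ℕ) = h j then 1 - q else 0))
    {i l : ℕ} (hl : l < m) (h1 : h l ≤ i) (h2 : i < h (l + 1)) :
    tailSum p (i + 1) = min 1 (max 0 (position b h l x)) := by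
  have hbj := H.b_succ C hj
  have hbl := H.b_succ C hl
  rw [tailSum_mix (H.le_k hj.le) (H.le_k (j := j + 1) hj) hp, position]
  rcases lt_trichotomy j l with hjl | rfl | hjl
  · have h3 := H.mono (show j + 1 ≤ l from hjl) hl.le
    have h4 := H.lt_succ j hj
    have h5 := C.b_le h3 (H.le_k hl.le)
    rw [if_neg (by omega), if_neg (by omega), max_eq_left, min_eq_right zero_le_one, add_zero]
    refine div_nonpos_of_nonpos_of_nonneg ?_ (by linarith)
    nlinarith
  · rw [if_pos (by omega), if_neg (by omega), hx, add_sub_cancel_left,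
      mul_div_cancel_left₀ _ (by linarith), max_eq_right hq0, min_eq_right hq1, add_zero]
  · have h3 := H.mono (show l + 1 ≤ j from hjl) hj.le
    have h4 := H.lt_succ j hj
    have h5 := C.b_le h3 (H.le_k hj.le)
    rw [if_pos (by omega), if_pos (by omega), add_sub_cancel, min_eq_left]
    refine le_max_of_le_right ?_
    rw [le_div_iff₀ (by linarith)]
    nlinarith

theorem Solves.isProfile {b r : ℕ → ℝ} (C : Costs k b r) (H : IsHull k b r m h τ)
    (S : Solves k b r m h τ c D) : IsProfile (D.profile k) := by
  obtain ⟨f, hfc, hfm, -, hf⟩ := S.path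
  have key : ∀ i, i < k → ∃ l, l < m ∧ ∀ t, 0 ≤ t →
      tailSum (D.profile k t) (i + 1) = min 1 (max 0 (position b h l (f t))) := by
    intro i hi
    obtain ⟨l, hl, h1, h2⟩ := H.exists_edge hi
    refine ⟨l, hl, fun t ht => ?_⟩
    obtain ⟨j, q, hj, hq0, hq1, hx, hp⟩ := S.exists_mix C H hf ht
    exact tailSum_mix_eq C H hj hq0 hq1 hx hp hl h1 h2
  refine ⟨?_, ?_, ?_, ?_⟩
  · intro t ht i
    obtain ⟨j, q, hj, hq0, hq1, hx, hp⟩ := S.exists_mix C H hf ht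
    rw [hp]
    have : 0 ≤ 1 - q := by linarith
    dsimp only
    positivity
  · intro t ht
    obtain ⟨j, q, hj, hq0, hq1, hx, hp⟩ := S.exists_mix C H hf ht
    have := sum_mix (H.le_k hj.le) (H.le_k hj) hp fun _ => 1
    simpa using this
  · intro i hi
    obtain ⟨l, hl, hlt⟩ := key i hi
    intro s hs t ht hst
    dsimp only
    rw [hlt s hs, hlt t ht, position, position]
    have := H.b_succ C hl
    have := hfm hst
    have : 0 ≤ b (h (l + 1)) - b (h l) := by linarith
    gcongr
  · intro i hi
    obtain ⟨l, hl, hlt⟩ := key i hi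
    refine ContinuousOn.congr (f := fun t => min 1 (max 0 (position b h l (f t)))) ?_
      fun t ht => hlt t ht
    unfold position
    fun_prop

theorem Solves.wellFormed {b r : ℕ → ℝ} (H : IsHull k b r m h τ)
    (S : Solves k b r m h τ c D) : D.WellFormed k := by
  obtain ⟨f, -, -, -, hf⟩ := S.path
  have key : ∀ n, n < D.size → D.lower n ≤ k ∧ D.upper n ≤ k := by
    intro n hn
    obtain ⟨j, hj, hl, hu, -⟩ := hf n hn (D.start n) le_rfl fun h1 => S.start_le n h1
    rw [hl, hu]
    exact ⟨H.le_k hj.le, H.le_k hj⟩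
  exact ⟨S.size_pos, S.start_zero, S.start_le, fun n hn => (key n hn).1, fun n hn => (key n hn).2⟩

theorem Solves.isCompetitive {M : Instance k} (H : IsHull k M.bSeq M.rSeq m h τ)
    (S : Solves k M.bSeq M.rSeq m h τ c D) : IsCompetitive M (strategyOf (D.profile k)) c := by
  have hprof := S.isProfile M.costs H
  obtain ⟨f, -, -, hle, hf⟩ := S.path
  intro t ht
  have hbuy : ∀ s, 0 ≤ s → M.buyCost (profileOf (strategyOf (D.profile k))) s = f s := by
    intro s hs
    obtain ⟨j, q, hj, hq0, hq1, hx, hp⟩ := S.exists_mix M.costs H hf hs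
    rw [Instance.buyCost, hprof.profileOf_strategyOf hs,
      sum_mix (H.le_k hj.le) (H.le_k hj) hp, hx, ← M.bSeq_val, ← M.bSeq_val]
    ring
  have hrent : ∀ s, 0 ≤ s → M.rentRate (profileOf (strategyOf (D.profile k))) s =
      hullRate M.bSeq M.rSeq m h τ (f s) := by
    intro s hs
    obtain ⟨j, q, hj, hq0, hq1, hx, hp⟩ := S.exists_mix M.costs H hf hs
    have hb := H.b_succ M.costs hj
    rw [Instance.rentRate, hprof.profileOf_strategyOf hs,
      sum_mix (H.le_k hj.le) (H.le_k hj) hp, hx,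
      hullRate_eq M.costs H hj (by nlinarith) (by nlinarith), edgeRate_eq M.costs H hj,
      ← M.rSeq_val, ← M.rSeq_val]
    ring
  obtain ⟨i, hi⟩ := exists_eq_ciInf_of_finite (f := fun i => M.b i + M.r i * t)
  have hint : ∫ z in (0 : ℝ)..t, M.rentRate (profileOf (strategyOf (D.profile k))) z =
      ∫ z in (0 : ℝ)..t, hullRate M.bSeq M.rSeq m h τ (f z) := by
    apply intervalIntegral.integral_congr
    intro z hz
    rw [Set.uIcc_of_le ht] at hz
    exact hrent z hz.1
  rw [Instance.totalCost, hbuy t ht, hint, Instance.opt, ← hi]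
  have := hle t ht i (Nat.lt_succ_iff.1 i.2)
  rwa [M.bSeq_val, M.rSeq_val] at this

/-- A factor for which the construction fails is a lower bound of the achievable factors. -/
theorem Instance.le_of_no_competitor (M : Instance k)
    (H : IsHull k M.bSeq M.rSeq m h τ) (hc : 0 ≤ c)
    (hno : ∀ R S, ¬ Competitor k M.bSeq M.rSeq m h τ c R S) :
    c ∈ lowerBounds M.achievable := by
  rintro c' ⟨μ, hμ, hcomp⟩
  by_contra hn
  exact hno _ _ ((hcomp.mono (not_le.1 hn).le).competitor hμ hc H)

theorem Instance.one_mem_lowerBounds (M : Instance k) (hk : 1 ≤ k)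
    (H : IsHull k M.bSeq M.rSeq m h τ) : 1 ∈ lowerBounds M.achievable := by
  intro c' hc'
  have h0 := M.achievable_nonneg hk hc'
  obtain ⟨μ, hμ, hcomp⟩ := hc'
  exact (hcomp.competitor hμ h0 H).one_le M.costs H (H.pos hk)

end

end SkiRental

/-! ### Arrays that a program does not change -/

namespace RealRAM

theorem Store.nat_setNat (σ : Store) (a i v a' : ℕ) :
    (σ.setNat a i v).nat a' = if a' = a then Function.update (σ.nat a) i v else σ.nat a' :=
  Function.update_apply _ _ _ _

theorem Store.real_setNat (σ : Store) (a i v : ℕ) : (σ.setNat a i v).real = σ.real := rfl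

theorem Store.nat_setReal (σ : Store) (a i : ℕ) (v : ℝ) : (σ.setReal a i v).nat = σ.nat := rfl

theorem Store.real_setReal (σ : Store) (a i : ℕ) (v : ℝ) (a' : ℕ) :
    (σ.setReal a i v).real a' = if a' = a then Function.update (σ.real a) i v else σ.real a' :=
  Function.update_apply _ _ _ _

/-- The program can write to the natural array `a`. -/
def Prog.SetsNat (a : ℕ) : Prog → Prop
  | .skip => False
  | .setNat a' _ _ => a = a'
  | .setReal _ _ _ => False
  | .seq P Q => P.SetsNat a ∨ Q.SetsNat a
  | .cond _ P Q => P.SetsNat a ∨ Q.SetsNat a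
  | .loop _ P => P.SetsNat a

/-- The program can write to the real array `a`. -/
def Prog.SetsReal (a : ℕ) : Prog → Prop
  | .skip => False
  | .setNat _ _ _ => False
  | .setReal a' _ _ => a = a'
  | .seq P Q => P.SetsReal a ∨ Q.SetsReal a
  | .cond _ P Q => P.SetsReal a ∨ Q.SetsReal a
  | .loop _ P => P.SetsReal a

theorem Prog.exec_nat {P : Prog} {a : ℕ} (h : ¬ P.SetsNat a) (σ : Store) :
    (P.exec σ).nat a = σ.nat a := by
  induction P generalizing σ with
  | setNat a' i e => exact (Store.nat_setNat _ _ _ _ _).trans (if_neg h)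
  | seq P Q ihP ihQ =>
    obtain ⟨h1, h2⟩ := not_or.1 h
    rw [Prog.exec, ihQ h2, ihP h1]
  | cond s P Q ihP ihQ =>
    obtain ⟨h1, h2⟩ := not_or.1 h
    rw [Prog.exec]
    split_ifs
    · exact ihP h1 σ
    · exact ihQ h2 σ
  | _ => rfl

theorem Prog.exec_real {P : Prog} {a : ℕ} (h : ¬ P.SetsReal a) (σ : Store) :
    (P.exec σ).real a = σ.real a := by
  induction P generalizing σ with
  | setReal a' i e => exact (Store.real_setReal _ _ _ _ _).trans (if_neg h)
  | seq P Q ihP ihQ =>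
    obtain ⟨h1, h2⟩ := not_or.1 h
    rw [Prog.exec, ihQ h2, ihP h1]
  | cond s P Q ihP ihQ =>
    obtain ⟨h1, h2⟩ := not_or.1 h
    rw [Prog.exec]
    split_ifs
    · exact ihP h1 σ
    · exact ihQ h2 σ
  | _ => rfl

end RealRAM

/-! ### The program

Besides the arrays for input and output, the program uses

* the natural array `4` and the real array `7` for the sequences `h` and `τ` of the envelope, and
  the natural variable `5` for its last index `m`,
* the natural variables `6`, `7`, `8`, `9` for the edge `j`, the optimal slope `e`, the status of
  the construction of a strategy, and the slope `i` that is added to the envelope,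
* the real variables `8` to `11` for the buying cost `B`, the factor `c`, and the bounds of the
  bisection, and `12` to `15` for the numbers that describe the next piece.
-/

namespace SkiRental

open RealRAM

/-- The single natural number in cell `0` of an array. -/
def natVar (a : ℕ) : NatExp := .get a (.lit 0)

/-- The single real number in cell `0` of an array. -/
def realVar (a : ℕ) : RealExp := .get a (.lit 0)

/-- The buying cost of slope `h j`; the natural array `4` holds `h`. -/
def hullB (j : NatExp) : RealExp := .get 0 (.get 4 j)

/-- The rental rate of slope `h j`. -/
def hullR (j : NatExp) : RealExp := .get 1 (.get 4 j)

/-- One step of the scan for the lower envelope. The natural variables `9` and `5` are the new slope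
`i` and the number `m`; the real array `7` holds `τ`. -/
def scanBody : Prog :=
  .cond (.and (.natLe (.lit 1) (natVar 5))
      (.realLe
        (.add (.get 0 (natVar 9))
          (.mul (.get 7 (.sub (natVar 5) (.lit 1))) (.get 1 (natVar 9))))
        (.add (hullB (natVar 5)) (.mul (.get 7 (.sub (natVar 5) (.lit 1))) (hullR (natVar 5))))))
    (.setNat 5 (.lit 0) (.sub (natVar 5) (.lit 1)))
    (.seq
      (.setReal 7 (natVar 5) (.div (.sub (.get 0 (natVar 9)) (hullB (natVar 5)))
        (.sub (hullR (natVar 5)) (.get 1 (natVar 9)))))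
    (.seq (.setNat 5 (.lit 0) (.add (natVar 5) (.lit 1)))
    (.seq (.setNat 4 (natVar 5) (natVar 9))
      (.setNat 9 (.lit 0) (.add (natVar 9) (.lit 1))))))

/-- The computation of the lower envelope. -/
def scan : Prog :=
  .seq (.setNat 9 (.lit 0) (.lit 1)) (.loop (.natLe (natVar 9) (natVar 0)) scanBody)

/-- Add a piece to the output. -/
def pushProg (l u : NatExp) (A Γ α t : RealExp) : Prog :=
  .seq (.setNat 2 (natVar 1) l)
  (.seq (.setNat 3 (natVar 1) u)
  (.seq (.setReal 4 (natVar 1) A)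
  (.seq (.setReal 5 (natVar 1) Γ)
  (.seq (.setReal 6 (natVar 1) α)
  (.seq (.setReal 3 (.add (natVar 1) (.lit 1)) t)
    (.setNat 1 (.lit 0) (.add (natVar 1) (.lit 1))))))))

/-- The end `j + 1` of the current edge; the natural variables `6` and `7` are `j` and `e`. -/
def edgeEnd : NatExp := .add (natVar 6) (.lit 1)

/-- The difference of the buying costs at the ends of the current edge. -/
def edgeLength : RealExp := .sub (hullB edgeEnd) (hullB (natVar 6))

/-- The start of the current piece. -/
def pieceStart : RealExp := .get 3 (natVar 1)

/-- Add the piece that follows the flow along the current edge; the real variables `12` and `13`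
hold `G` and `X`, and `15` the end of the piece. -/
def flowPiece : Prog :=
  pushProg (.get 4 (natVar 6)) (.get 4 edgeEnd) (.sub (.lit 0) (realVar 12))
    (.mul (realVar 13) (.exp (.div (.sub (.lit 0) pieceStart) (.get 7 (natVar 6)))))
    (.div (.lit 1) (.get 7 (natVar 6))) (realVar 15)

/-- Follow the flow to the end of the current edge. -/
def crossEdge : Prog :=
  .seq (.setReal 15 (.lit 0) (.add pieceStart (.mul (.get 7 (natVar 6))
      (.log (.div (.add (.lit 1) (realVar 12)) (realVar 13))))))
  (.seq flowPiece
  (.seq (.setReal 8 (.lit 0) (hullB edgeEnd))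
    (.setNat 6 (.lit 0) edgeEnd)))

/-- Follow the flow until the optimal slope changes; the real variable `14` is the position on the
edge at that time. -/
def crossSlope : Prog :=
  .seq (.setReal 15 (.lit 0) (.get 7 (natVar 7)))
  (.seq flowPiece
  (.seq (.setReal 8 (.lit 0) (.add (hullB (natVar 6)) (.mul edgeLength (realVar 14))))
    (.setNat 7 (.lit 0) (.add (natVar 7) (.lit 1)))))

/-- Compute `G` and `X`. -/
def computeSpeed : Prog :=
  .seq (.setReal 12 (.lit 0) (.div (.sub (.mul (realVar 9) (hullR (natVar 7))) (hullR (natVar 6)))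
      (.sub (hullR (natVar 6)) (hullR edgeEnd))))
    (.setReal 13 (.lit 0)
      (.add (.div (.sub (realVar 8) (hullB (natVar 6))) edgeLength) (realVar 12)))

/-- Compute the position on the current edge when the optimal slope changes. -/
def computePosition : Prog :=
  .setReal 14 (.lit 0) (.add (.sub (.lit 0) (realVar 12)) (.mul (realVar 13)
    (.exp (.div (.sub (.get 7 (natVar 7)) pieceStart) (.get 7 (natVar 6))))))

/-- The last piece if all probability has moved to slope `k`. -/
def lastPiece : Prog :=
  .seq (pushProg (.get 4 (.sub (natVar 5) (.lit 1))) (.get 4 (natVar 5)) (.lit 1) (.lit 0) (.lit 0)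
      (.lit 0))
    (.setNat 8 (.lit 0) (.lit 1))

/-- The last piece if the probabilities do not change any more. -/
def stationaryPiece : Prog :=
  .seq flowPiece (.setNat 8 (.lit 0) (.lit 1))

/-- One step of the construction of a strategy. The natural variable `8` is the status: `0` while
the construction goes on, `1` if it succeeded and `2` if it failed. The real variables `8` and `9`
hold `B` and `c`. -/
def pathBody : Prog :=
  .cond (.natLe (natVar 5) (natVar 6)) lastPiece
    (.cond (.realLe (hullB edgeEnd) (realVar 8)) (.setNat 6 (.lit 0) edgeEnd)
      (.seq computeSpeed
        (.cond (.realLe (.lit 0) (realVar 13))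
          (.cond (.natLe (natVar 5) (natVar 7))
            (.cond (.realLe (realVar 13) (.lit 0)) stationaryPiece crossEdge)
            (.seq computePosition
              (.cond (.realLe (realVar 14) (.lit 1)) crossSlope crossEdge)))
          (.setNat 8 (.lit 0) (.lit 2)))))

/-- The initial state of the construction of a strategy. -/
def pathInit : Prog :=
  .seq (.setNat 1 (.lit 0) (.lit 0))
  (.seq (.setReal 3 (.lit 0) (.lit 0))
  (.seq (.setReal 8 (.lit 0) (.mul (realVar 9) (.get 0 (.lit 0))))
  (.seq (.setNat 6 (.lit 0) (.lit 0))
  (.seq (.setNat 7 (.lit 0) (.lit 0))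
    (.setNat 8 (.lit 0) (.lit 0))))))

/-- The construction of a `c`-competitive strategy. -/
def path : Prog := .seq pathInit (.loop (.natLe (natVar 8) (.lit 0)) pathBody)

/-- One step of the bisection. The real variables `10` and `11` hold the bounds. -/
def bisectBody : Prog :=
  .seq (.setReal 9 (.lit 0) (.div (.add (realVar 10) (realVar 11)) (.lit 2)))
  (.seq path
    (.cond (.natLe (natVar 8) (.lit 1)) (.setReal 11 (.lit 0) (realVar 9))
      (.setReal 10 (.lit 0) (realVar 9))))

/-- The initial bounds `1` and `2` of the bisection. -/
def bisectInit : Prog :=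
  .seq (.setReal 10 (.lit 0) (.lit 1)) (.setReal 11 (.lit 0) (.lit 2))

/-- The bisection for the competitive ratio, up to the precision `ε`. -/
def bisect : Prog :=
  .seq bisectInit
    (.loop (.not (.realLe (realVar 11) (.add (realVar 10) (realVar 2)))) bisectBody)

/-- The whole program. -/
def skiRentalProg : Prog :=
  .seq scan (.seq bisect (.seq (.setReal 9 (.lit 0) (realVar 11)) path))

/-- The memory holds the input. -/
structure HasInput (k : ℕ) (b r : ℕ → ℝ) (ε : ℝ) (σ : Store) : Prop where
  nat_zero : σ.nat 0 0 = k
  real_zero : σ.real 0 = b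
  real_one : σ.real 1 = r
  real_two : σ.real 2 0 = ε

/-- The memory holds the lower envelope. -/
structure HasHull (b r : ℕ → ℝ) (ε : ℝ) (m : ℕ) (h : ℕ → ℕ) (τ : ℕ → ℝ) (σ : Store) : Prop where
  real_zero : σ.real 0 = b
  real_one : σ.real 1 = r
  real_two : σ.real 2 0 = ε
  nat_five : σ.nat 5 0 = m
  nat_four : σ.nat 4 = h
  real_seven : σ.real 7 = τ

section
variable {k m : ℕ} {b r : ℕ → ℝ} {h : ℕ → ℕ} {τ : ℕ → ℝ} {ε : ℝ} {σ : Store}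

theorem scanBody_loopFree : scanBody.LoopFree := by
  simp [scanBody, Prog.LoopFree]

theorem scan_achieves (C : Costs k b r) (hk : 1 ≤ k) (hin : HasInput k b r ε σ)
    (hm : σ.nat 5 0 = 0) (h0 : σ.nat 4 0 = 0) :
    Achieves scan σ (3 + (2 * k * (3 + 2 + scanBody.maxCost) + 5)) fun ρ =>
      ∃ m h τ, IsHull k b r m h τ ∧ HasHull b r ε m h τ ρ := by
  let I : ℕ → Store → Prop := fun v ρ => HasInput k b r ε ρ ∧
    ScanInv k b r (ρ.nat 9 0) (ρ.nat 5 0) (ρ.nat 4) (ρ.real 7) ∧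
    v = 2 * (k + 1 - ρ.nat 9 0) + ρ.nat 5 0
  have hbody : ∀ v ρ, I v ρ → (Test.natLe (natVar 9) (natVar 0)).eval ρ →
      Achieves scanBody ρ scanBody.maxCost fun ρ' => ∃ w, w < v ∧ I w ρ' := by
    rintro v ρ ⟨hin, hS, rfl⟩ hs
    apply scanBody_loopFree.achieves
    have hi : ρ.nat 9 0 ≤ k := by
      simpa [Test.eval, NatExp.eval, natVar, hin.nat_zero] using hs
    by_cases hpop : 1 ≤ ρ.nat 5 0 ∧ b (ρ.nat 9 0) + ρ.real 7 (ρ.nat 5 0 - 1) * r (ρ.nat 9 0) ≤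
        b (ρ.nat 4 (ρ.nat 5 0)) + ρ.real 7 (ρ.nat 5 0 - 1) * r (ρ.nat 4 (ρ.nat 5 0))
    · have hexec : scanBody.exec ρ = ρ.setNat 5 0 (ρ.nat 5 0 - 1) := by
        simp [scanBody, Prog.exec, Test.eval, RealExp.eval, NatExp.eval, natVar, hullB, hullR,
          hin.real_zero, hin.real_one, hpop]
      rw [hexec]
      obtain ⟨n, hn⟩ : ∃ n, ρ.nat 5 0 = n + 1 := ⟨ρ.nat 5 0 - 1, by omega⟩
      refine ⟨_, ?_, ⟨?_, ?_, ?_, ?_⟩, ?_, rfl⟩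
      · simp [Store.nat_setNat, hn]
      · simpa [Store.nat_setNat] using hin.nat_zero
      · simpa [Store.real_setNat] using hin.real_zero
      · simpa [Store.real_setNat] using hin.real_one
      · simpa [Store.real_setNat] using hin.real_two
      · rw [hn] at hS hpop
        simpa [Store.nat_setNat, Store.real_setNat, hn] using hS.pop C hi hpop.2
    · have hexec : scanBody.exec ρ = (((ρ.setReal 7 (ρ.nat 5 0)
          ((b (ρ.nat 9 0) - b (ρ.nat 4 (ρ.nat 5 0))) /
            (r (ρ.nat 4 (ρ.nat 5 0)) - r (ρ.nat 9 0)))).setNat 5 0 (ρ.nat 5 0 + 1)).setNat 4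
          (ρ.nat 5 0 + 1) (ρ.nat 9 0)).setNat 9 0 (ρ.nat 9 0 + 1) := by
        simp [scanBody, Prog.exec, Test.eval, RealExp.eval, NatExp.eval, natVar, hullB, hullR,
          hin.real_zero, hin.real_one, hpop, Store.nat_setNat, Store.nat_setReal]
      rw [hexec]
      refine ⟨_, ?_, ⟨?_, ?_, ?_, ?_⟩, ?_, rfl⟩
      · simp [Store.nat_setNat, Store.nat_setReal]; omega
      · simpa [Store.nat_setNat, Store.nat_setReal] using hin.nat_zero
      · simpa [Store.real_setNat, Store.real_setReal] using hin.real_zero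
      · simpa [Store.real_setNat, Store.real_setReal] using hin.real_one
      · simpa [Store.real_setNat, Store.real_setReal] using hin.real_two
      · have hlt : ∀ j, j + 1 = ρ.nat 5 0 → b (ρ.nat 4 (ρ.nat 5 0)) +
            ρ.real 7 j * r (ρ.nat 4 (ρ.nat 5 0)) < b (ρ.nat 9 0) + ρ.real 7 j * r (ρ.nat 9 0) := by
          intro j hj
          rw [← hj] at hpop ⊢
          simpa using hpop
        simpa [Store.nat_setNat, Store.nat_setReal, Store.real_setNat, Store.real_setReal]
          using hS.push C hi hlt
  have hinit : Achieves (.setNat 9 (.lit 0) (.lit 1)) σ 3 fun ρ => I (2 * k) ρ := by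
    refine (show Prog.LoopFree (.setNat 9 (.lit 0) (.lit 1)) from trivial).achieves
      ⟨⟨?_, ?_, ?_, ?_⟩, ?_, ?_⟩
    · simpa [Prog.exec, Store.nat_setNat] using hin.nat_zero
    · simpa [Prog.exec, Store.real_setNat] using hin.real_zero
    · simpa [Prog.exec, Store.real_setNat] using hin.real_one
    · simpa [Prog.exec, Store.real_setNat] using hin.real_two
    · simpa [Prog.exec, NatExp.eval, Store.nat_setNat, Store.real_setNat, hm] using
        ScanInv.start h0 hk
    · simp [Prog.exec, NatExp.eval, Store.nat_setNat, hm]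
  refine hinit.seq fun ρ hρ => (Achieves.loop hbody _ ρ hρ).mono le_rfl ?_
  rintro ρ' ⟨⟨w, hin', hS, -⟩, hs⟩
  have hi : k < ρ'.nat 9 0 := by
    simpa [Test.eval, NatExp.eval, natVar, hin'.nat_zero] using hs
  exact ⟨_, _, _, hS.isHull hi, hin'.real_zero, hin'.real_one, hin'.real_two, rfl, rfl, rfl⟩

end

end SkiRental

/-! ### Correctness of the construction of a strategy -/

namespace SkiRental

open RealRAM

section
variable {k m : ℕ} {b r : ℕ → ℝ} {h : ℕ → ℕ} {τ : ℕ → ℝ} {ε c : ℝ} {σ : Store}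

theorem pathBody_loopFree : pathBody.LoopFree := by
  simp [pathBody, lastPiece, stationaryPiece, crossEdge, crossSlope, computeSpeed, computePosition,
    flowPiece, pushProg, Prog.LoopFree]

theorem pathInit_loopFree : pathInit.LoopFree := by
  simp [pathInit, Prog.LoopFree]

theorem HasHull.exec_pathInit (hσ : HasHull b r ε m h τ σ) :
    HasHull b r ε m h τ (pathInit.exec σ) := by
  refine ⟨?_, ?_, ?_, ?_, ?_, ?_⟩ <;> first | rw [Prog.exec_real] | rw [Prog.exec_nat]
  all_goals first | exact hσ.1 | exact hσ.2 | exact hσ.3 | exact hσ.4 | exact hσ.5 | exact hσ.6 |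
    simp [pathInit, Prog.SetsNat, Prog.SetsReal]

theorem pathBody_sets_nat {a : ℕ} (ha : a = 4 ∨ a = 5) : ¬ pathBody.SetsNat a := by
  simp only [pathBody, lastPiece, stationaryPiece, crossEdge, crossSlope, computeSpeed,
    computePosition, flowPiece, pushProg, Prog.SetsNat, false_or, or_self]
  omega

theorem pathBody_sets_real {a : ℕ} (ha : a < 3 ∨ a = 7 ∨ (9 ≤ a ∧ a < 12)) :
    ¬ pathBody.SetsReal a := by
  simp only [pathBody, lastPiece, stationaryPiece, crossEdge, crossSlope, computeSpeed,
    computePosition, flowPiece, pushProg, Prog.SetsReal, or_false, false_or, or_self]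
  omega

theorem HasHull.exec_pathBody (hσ : HasHull b r ε m h τ σ) :
    HasHull b r ε m h τ (pathBody.exec σ) := by
  refine ⟨?_, ?_, ?_, ?_, ?_, ?_⟩ <;>
    first | rw [Prog.exec_real (pathBody_sets_real (by omega))]
          | rw [Prog.exec_nat (pathBody_sets_nat (by omega))]
  exacts [hσ.1, hσ.2, hσ.3, hσ.4, hσ.5, hσ.6]

theorem flowPiece_output (ρ : Store) : outputDescription (flowPiece.exec ρ) =
    (outputDescription ρ).push (ρ.nat 4 (ρ.nat 6 0)) (ρ.nat 4 (ρ.nat 6 0 + 1)) (-ρ.real 12 0)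
      (ρ.real 13 0 * Real.exp ((0 - ρ.real 3 (ρ.nat 1 0)) / ρ.real 7 (ρ.nat 6 0)))
      (1 / ρ.real 7 (ρ.nat 6 0)) (ρ.real 15 0) := by
  simp [flowPiece, pushProg, outputDescription, Description.push, Prog.exec, RealExp.eval,
    NatExp.eval, natVar, realVar, edgeEnd, pieceStart, Store.nat_setNat, Store.nat_setReal,
    Store.real_setNat, Store.real_setReal]

theorem flowPiece_nat (ρ : Store) {a : ℕ} (ha : a = 0 ∨ 3 < a) :
    (flowPiece.exec ρ).nat a = ρ.nat a := by
  apply Prog.exec_nat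
  simp only [flowPiece, pushProg, Prog.SetsNat, false_or]
  omega

theorem flowPiece_real (ρ : Store) {a : ℕ} (ha : a < 3 ∨ 6 < a) :
    (flowPiece.exec ρ).real a = ρ.real a := by
  apply Prog.exec_real
  simp only [flowPiece, pushProg, Prog.SetsReal, or_false, false_or]
  omega

/-- The construction has ended: it succeeded with status `1`, or it failed with status `2`. -/
def PathResult (k : ℕ) (b r : ℕ → ℝ) (m : ℕ) (h : ℕ → ℕ) (τ : ℕ → ℝ) (c : ℝ) (σ : Store) : Prop :=
  (σ.nat 8 0 = 1 ∧ Solves k b r m h τ c (outputDescription σ)) ∨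
    (σ.nat 8 0 = 2 ∧ c < 2 ∧ ∀ R S, ¬ Competitor k b r m h τ c R S)

/-- The invariant of the construction, with the variant `v`. -/
def PathLoopInv (k : ℕ) (b r : ℕ → ℝ) (m : ℕ) (h : ℕ → ℕ) (τ : ℕ → ℝ) (c : ℝ) (v : ℕ)
    (σ : Store) : Prop :=
  (σ.nat 8 0 = 0 ∧ v = 2 * m + 1 - σ.nat 6 0 - σ.nat 7 0 ∧
    PathInv k b r m h τ c (outputDescription σ) (σ.real 8 0) (σ.nat 6 0) (σ.nat 7 0)) ∨
  (v = 0 ∧ PathResult k b r m h τ c σ)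

/-- The step to the next edge. By `hlate`, the end of the edge is reached before the optimal slope
changes. -/
theorem crossEdge_inv (C : Costs k b r) (H : IsHull k b r m h τ) (hc : 1 ≤ c)
    (hσ : HasHull b r ε m h τ σ) (h8 : σ.nat 8 0 = 0)
    (I : PathInv k b r m h τ c (outputDescription σ) (σ.real 8 0) (σ.nat 6 0) (σ.nat 7 0))
    (hj : σ.nat 6 0 < m) (hB : σ.real 8 0 < b (h (σ.nat 6 0 + 1)))
    (h12 : σ.real 12 0 = gap r h c (σ.nat 6 0) (σ.nat 7 0))
    (h13 : σ.real 13 0 = position b h (σ.nat 6 0) (σ.real 8 0) +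
      gap r h c (σ.nat 6 0) (σ.nat 7 0))
    (hX : 0 < σ.real 13 0)
    (hlate : σ.nat 7 0 < m → b (h (σ.nat 6 0 + 1)) < flow b h τ (σ.nat 6 0) (σ.real 12 0)
      (σ.real 13 0) (σ.real 3 (σ.nat 1 0)) (τ (σ.nat 7 0))) :
    ∃ w, w < 2 * m + 1 - σ.nat 6 0 - σ.nat 7 0 ∧
      PathLoopInv k b r m h τ c w (crossEdge.exec σ) := by
  set j := σ.nat 6 0 with hjdef
  set e := σ.nat 7 0 with hedef
  set B := σ.real 8 0 with hBdef
  set G := σ.real 12 0 with hG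
  set X := σ.real 13 0 with hXdef
  set t₀ := σ.real 3 (σ.nat 1 0) with ht₀
  set t₁ := t₀ + τ j * Real.log ((1 + G) / X) with ht₁
  have hτ := H.tau_pos C hj
  have hb := H.b_succ C hj
  have hXG : X < 1 + G := by
    have h1 := position_mul C H hj B
    have h2 : position b h j B < 1 := by
      by_contra hn
      nlinarith
    rw [h13, ← h12]; linarith
  have hmono := flow_mono C H hj (G := G) (t₀ := t₀) hX.le
  have hflow1 : flow b h τ j G X t₀ t₁ = b (h (j + 1)) := by
    have h1 : (t₁ - t₀) / τ j = Real.log ((1 + G) / X) := by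
      rw [ht₁, add_sub_cancel_left, mul_div_cancel_left₀ _ hτ.ne']
    rw [flow, h1, Real.exp_log (div_pos (by linarith) hX), mul_div_cancel₀ _ hX.ne']
    ring
  have htt : t₀ ≤ t₁ := by
    have : 0 ≤ Real.log ((1 + G) / X) := Real.log_nonneg ((one_le_div hX).2 hXG.le)
    rw [ht₁]
    have := mul_nonneg hτ.le this
    linarith
  have hte : e < m → t₁ ≤ τ e := by
    intro he
    by_contra hn
    have h1 := hmono (not_le.1 hn).le
    have h2 := hlate he
    rw [hflow1] at h1
    linarith
  have hpiece := I.piece C H hc hj hB h13 hX.le (t₁ := t₁) htt hte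
    (by rw [← h12]; exact hflow1.le)
  have hstart : (outputDescription σ).start (outputDescription σ).size = t₀ := rfl
  rw [hstart, ← h12, hflow1] at hpiece
  -- the memory after the assignment to the real variable `15`
  set ρ := σ.setReal 15 0 t₁ with hρ
  have hexec : crossEdge.exec σ = ((flowPiece.exec ρ).setReal 8 0 (b (h (j + 1)))).setNat 6 0
      (j + 1) := by
    have e1 : ((.setReal 15 (.lit 0) (.add pieceStart (.mul (.get 7 (natVar 6))
      (.log (.div (.add (.lit 1) (realVar 12)) (realVar 13))))) : Prog)).exec σ = ρ := by
      simp [Prog.exec, RealExp.eval, NatExp.eval, pieceStart, natVar, realVar, hσ.real_seven, hρ,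
        ht₁, ht₀, hG, hXdef, hjdef]
    rw [crossEdge, Prog.exec, e1]
    simp [Prog.exec, RealExp.eval, NatExp.eval, natVar, hullB, edgeEnd, flowPiece_nat,
      flowPiece_real, Store.nat_setReal, hρ, Store.real_setReal, hσ.real_zero, hσ.nat_four, hjdef]
  have hout : outputDescription (crossEdge.exec σ) = (outputDescription σ).push (h j) (h (j + 1))
      (-G) (X * Real.exp ((0 - t₀) / τ j)) (1 / τ j) t₁ := by
    have e1 := flowPiece_output ρ
    simp only [hρ, Store.nat_setReal, Store.real_setReal, hσ.nat_four, hσ.real_seven] at e1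
    have e2 : outputDescription (crossEdge.exec σ) = outputDescription (flowPiece.exec ρ) := by
      rw [hexec]; rfl
    rw [e2, hρ, e1]
    simp [hjdef, hG, hXdef, ht₀, outputDescription, Store.nat_setReal, Store.real_setReal]
  refine ⟨2 * m + 1 - (j + 1) - e, by have := I.e_le; omega, Or.inl ⟨?_, ?_, ?_⟩⟩
  · rw [hexec]
    simpa [Store.nat_setNat, Store.nat_setReal, flowPiece_nat, hρ] using h8
  · rw [hexec]
    simp [Store.nat_setNat, Store.nat_setReal, flowPiece_nat, hρ, hedef]
  · rw [hout]
    have e1 : (crossEdge.exec σ).real 8 0 = b (h (j + 1)) := by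
      rw [hexec]; simp [Store.real_setNat, Store.real_setReal]
    have e2 : (crossEdge.exec σ).nat 6 0 = j + 1 := by
      rw [hexec]; simp [Store.nat_setNat]
    have e3 : (crossEdge.exec σ).nat 7 0 = e := by
      rw [hexec]; simp [Store.nat_setNat, Store.nat_setReal, flowPiece_nat, hρ, hedef]
    rw [e1, e2, e3]
    exact hpiece.next_edge hj le_rfl

/-- The step to the next optimal slope. By `hend`, the end of the edge is not reached before the
optimal slope changes. -/
theorem crossSlope_inv (C : Costs k b r) (H : IsHull k b r m h τ) (hc : 1 ≤ c)
    (hσ : HasHull b r ε m h τ σ) (h8 : σ.nat 8 0 = 0)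
    (I : PathInv k b r m h τ c (outputDescription σ) (σ.real 8 0) (σ.nat 6 0) (σ.nat 7 0))
    (hj : σ.nat 6 0 < m) (hB : σ.real 8 0 < b (h (σ.nat 6 0 + 1)))
    (h12 : σ.real 12 0 = gap r h c (σ.nat 6 0) (σ.nat 7 0))
    (h13 : σ.real 13 0 = position b h (σ.nat 6 0) (σ.real 8 0) +
      gap r h c (σ.nat 6 0) (σ.nat 7 0))
    (hX : 0 ≤ σ.real 13 0) (he : σ.nat 7 0 < m)
    (h14 : b (h (σ.nat 6 0)) + (b (h (σ.nat 6 0 + 1)) - b (h (σ.nat 6 0))) * σ.real 14 0 =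
      flow b h τ (σ.nat 6 0) (σ.real 12 0) (σ.real 13 0) (σ.real 3 (σ.nat 1 0)) (τ (σ.nat 7 0)))
    (hend : σ.real 14 0 ≤ 1) :
    ∃ w, w < 2 * m + 1 - σ.nat 6 0 - σ.nat 7 0 ∧
      PathLoopInv k b r m h τ c w (crossSlope.exec σ) := by
  set j := σ.nat 6 0 with hjdef
  set e := σ.nat 7 0 with hedef
  set B := σ.real 8 0 with hBdef
  set G := σ.real 12 0 with hG
  set X := σ.real 13 0 with hXdef
  set t₀ := σ.real 3 (σ.nat 1 0) with ht₀
  have hb := H.b_succ C hj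
  have hstart : (outputDescription σ).start (outputDescription σ).size = t₀ := rfl
  have hpiece := I.piece C H hc hj hB h13 hX (t₁ := τ e) (I.right he) (fun _ => le_rfl)
    (by rw [← h12, hstart, ← h14]; nlinarith)
  rw [hstart, ← h12, ← h14] at hpiece
  -- the memory after the assignment to the real variable `15`
  set ρ := σ.setReal 15 0 (τ e) with hρ
  have hexec : crossSlope.exec σ = ((flowPiece.exec ρ).setReal 8 0
      (b (h j) + (b (h (j + 1)) - b (h j)) * σ.real 14 0)).setNat 7 0 (e + 1) := by
    have e1 : ((.setReal 15 (.lit 0) (.get 7 (natVar 7)) : Prog)).exec σ = ρ := by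
      simp [Prog.exec, RealExp.eval, NatExp.eval, natVar, hσ.real_seven, hρ, hedef]
    rw [crossSlope, Prog.exec, e1]
    simp [Prog.exec, RealExp.eval, NatExp.eval, natVar, realVar, hullB, edgeEnd, edgeLength,
      flowPiece_nat, flowPiece_real, Store.nat_setReal, hρ, Store.real_setReal, hσ.real_zero,
      hσ.nat_four, hjdef, hedef]
  have hout : outputDescription (crossSlope.exec σ) = (outputDescription σ).push (h j) (h (j + 1))
      (-G) (X * Real.exp ((0 - t₀) / τ j)) (1 / τ j) (τ e) := by
    have e1 := flowPiece_output ρ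
    simp only [hρ, Store.nat_setReal, Store.real_setReal, hσ.nat_four, hσ.real_seven] at e1
    have e2 : outputDescription (crossSlope.exec σ) = outputDescription (flowPiece.exec ρ) := by
      rw [hexec]; rfl
    rw [e2, hρ, e1]
    simp [hjdef, hG, hXdef, ht₀, outputDescription, Store.nat_setReal, Store.real_setReal]
  refine ⟨2 * m + 1 - j - (e + 1), by omega, Or.inl ⟨?_, ?_, ?_⟩⟩
  · rw [hexec]
    simpa [Store.nat_setNat, Store.nat_setReal, flowPiece_nat, hρ] using h8
  · rw [hexec]
    simp [Store.nat_setNat, Store.nat_setReal, flowPiece_nat, hρ, hjdef]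
  · rw [hout]
    have e1 : (crossSlope.exec σ).real 8 0 =
        b (h j) + (b (h (j + 1)) - b (h j)) * σ.real 14 0 := by
      rw [hexec]; simp [Store.real_setNat, Store.real_setReal]
    have e2 : (crossSlope.exec σ).nat 6 0 = j := by
      rw [hexec]; simp [Store.nat_setNat, Store.nat_setReal, flowPiece_nat, hρ, hjdef]
    have e3 : (crossSlope.exec σ).nat 7 0 = e + 1 := by
      rw [hexec]; simp [Store.nat_setNat]
    rw [e1, e2, e3]
    exact hpiece.next_slope H he (Function.update_self _ _ _)

end

end SkiRental

namespace SkiRental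

open RealRAM

section
variable {k m : ℕ} {b r : ℕ → ℝ} {h : ℕ → ℕ} {τ : ℕ → ℝ} {ε c : ℝ} {σ : Store}

theorem pathBody_inv (C : Costs k b r) (H : IsHull k b r m h τ) (hm : 0 < m) (hc : 1 ≤ c)
    (hσ : HasHull b r ε m h τ σ) (h9 : σ.real 9 0 = c) (h8 : σ.nat 8 0 = 0)
    (I : PathInv k b r m h τ c (outputDescription σ) (σ.real 8 0) (σ.nat 6 0) (σ.nat 7 0)) :
    ∃ w, w < 2 * m + 1 - σ.nat 6 0 - σ.nat 7 0 ∧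
      PathLoopInv k b r m h τ c w (pathBody.exec σ) := by
  have hje : 0 < 2 * m + 1 - σ.nat 6 0 - σ.nat 7 0 := by
    have := I.j_le
    have := I.e_le
    omega
  rcases Nat.lt_or_ge (σ.nat 6 0) m with hj | hj
  swap
  · have hexec : pathBody.exec σ = lastPiece.exec σ := by
      simp [pathBody, Prog.exec, Test.eval, NatExp.eval, natVar, hσ.nat_five, hj]
    rw [hexec]
    refine ⟨0, hje, Or.inr ⟨rfl, Or.inl ⟨?_, ?_⟩⟩⟩
    · simp [lastPiece, Prog.exec, NatExp.eval, Store.nat_setNat]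
    · have hjm : σ.nat 6 0 = m := le_antisymm I.j_le hj
      rw [hjm] at I
      have hout : outputDescription (lastPiece.exec σ) =
          (outputDescription σ).push (h (m - 1)) (h m) 1 0 0 0 := by
        simp [lastPiece, pushProg, outputDescription, Description.push, Prog.exec, RealExp.eval,
          NatExp.eval, natVar, Store.nat_setNat, Store.nat_setReal, Store.real_setNat,
          Store.real_setReal, hσ.nat_five, hσ.nat_four]
      rw [hout]
      exact I.finish_last C H hm hc 0
  rcases le_or_gt (b (h (σ.nat 6 0 + 1))) (σ.real 8 0) with hB | hB
  · have hexec : pathBody.exec σ = σ.setNat 6 0 (σ.nat 6 0 + 1) := by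
      simp [pathBody, Prog.exec, Test.eval, NatExp.eval, RealExp.eval, natVar, realVar, hullB,
        edgeEnd, hσ.nat_five, hσ.nat_four, hσ.real_zero, hj, hB]
    rw [hexec]
    refine ⟨2 * m + 1 - (σ.nat 6 0 + 1) - σ.nat 7 0, by have := I.e_le; omega, Or.inl ⟨?_, ?_, ?_⟩⟩
    · simpa [Store.nat_setNat] using h8
    · simp [Store.nat_setNat]
    · simpa [Store.nat_setNat, Store.real_setNat, outputDescription] using I.next_edge hj hB
  -- the memory after the computation of the speed
  set ρ := computeSpeed.exec σ with hρ
  have hρn : ∀ a, ρ.nat a = σ.nat a := fun a =>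
    Prog.exec_nat (by simp [computeSpeed, Prog.SetsNat]) σ
  have hρr : ∀ a, a < 12 → ρ.real a = σ.real a := fun a ha =>
    Prog.exec_real (by simp only [computeSpeed, Prog.SetsReal]; omega) σ
  have hρ12 : ρ.real 12 0 = gap r h c (σ.nat 6 0) (σ.nat 7 0) := by
    simp [hρ, computeSpeed, Prog.exec, RealExp.eval, NatExp.eval, natVar, realVar, hullR, hullB,
      edgeEnd, Store.nat_setReal, Store.real_setReal, hσ.nat_four, hσ.real_one, h9, gap]
  have hρ13 : ρ.real 13 0 = position b h (σ.nat 6 0) (σ.real 8 0) +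
      gap r h c (σ.nat 6 0) (σ.nat 7 0) := by
    simp [hρ, computeSpeed, Prog.exec, RealExp.eval, NatExp.eval, natVar, realVar, hullR, hullB,
      edgeEnd, edgeLength, Store.nat_setReal, Store.real_setReal, hσ.nat_four, hσ.real_one,
      hσ.real_zero, h9, gap, position]
  have hρout : outputDescription ρ = outputDescription σ := by
    simp [outputDescription, hρn, hρr]
  have hρσ : HasHull b r ε m h τ ρ := by
    refine ⟨?_, ?_, ?_, ?_, ?_, ?_⟩ <;> first | rw [hρr _ (by omega)] | rw [hρn]
    exacts [hσ.1, hσ.2, hσ.3, hσ.4, hσ.5, hσ.6]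
  have hexec : pathBody.exec σ = (Prog.cond (.realLe (.lit 0) (realVar 13))
      (.cond (.natLe (natVar 5) (natVar 7))
        (.cond (.realLe (realVar 13) (.lit 0)) stationaryPiece crossEdge)
        (.seq computePosition
          (.cond (.realLe (realVar 14) (.lit 1)) crossSlope crossEdge)))
      (.setNat 8 (.lit 0) (.lit 2))).exec ρ := by
    rw [pathBody, Prog.exec, if_neg, Prog.exec, if_neg, Prog.exec]
    · simp [Test.eval, NatExp.eval, RealExp.eval, natVar, realVar, hullB,
        edgeEnd, hσ.nat_four, hσ.real_zero, hB]
    · simp [Test.eval, NatExp.eval, natVar, hσ.nat_five, hj]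
  rw [hexec]
  simp only [← hρn, ← hρr 8 (by norm_num)] at h8 hj hB hje hρ12 hρ13 I ⊢
  rw [← hρout] at I
  rcases lt_or_ge (ρ.real 13 0) 0 with hX | hX
  · have hexec' : ∀ P, (Prog.cond (.realLe (.lit 0) (realVar 13)) P
        (.setNat 8 (.lit 0) (.lit 2))).exec ρ = ρ.setNat 8 0 2 := by
      intro P
      simp [Prog.exec, Test.eval, NatExp.eval, RealExp.eval, realVar, hX]
    rw [hexec']
    rw [hρ13] at hX
    exact ⟨0, hje, Or.inr ⟨rfl, Or.inr ⟨by simp [Store.nat_setNat], I.lt_two C H hj hB hX,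
      I.no_competitor C H hj hX⟩⟩⟩
  rw [Prog.exec, if_pos (by simpa [Test.eval, NatExp.eval, RealExp.eval, realVar] using hX)]
  rcases Nat.lt_or_ge (ρ.nat 7 0) m with he | he
  · rw [Prog.exec, if_neg (by simpa [Test.eval, NatExp.eval, natVar, hρσ.nat_five] using he),
      Prog.exec]
    -- the memory after the computation of the position
    set ρ' := computePosition.exec ρ with hρ'
    have hρn' : ∀ a, ρ'.nat a = ρ.nat a := fun a =>
      Prog.exec_nat (by simp [computePosition, Prog.SetsNat]) ρ
    have hρr' : ∀ a, a < 14 → ρ'.real a = ρ.real a := fun a ha =>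
      Prog.exec_real (by simp only [computePosition, Prog.SetsReal]; omega) ρ
    have hρ14 : b (h (ρ.nat 6 0)) + (b (h (ρ.nat 6 0 + 1)) - b (h (ρ.nat 6 0))) * ρ'.real 14 0 =
        flow b h τ (ρ.nat 6 0) (ρ.real 12 0) (ρ.real 13 0) (ρ.real 3 (ρ.nat 1 0))
          (τ (ρ.nat 7 0)) := by
      simp [hρ', computePosition, Prog.exec, RealExp.eval, NatExp.eval, natVar, realVar,
        pieceStart, Store.real_setReal, hρσ.real_seven, flow]
    have hρσ' : HasHull b r ε m h τ ρ' := by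
      refine ⟨?_, ?_, ?_, ?_, ?_, ?_⟩ <;> first | rw [hρr' _ (by omega)] | rw [hρn']
      exacts [hρσ.1, hρσ.2, hρσ.3, hρσ.4, hρσ.5, hρσ.6]
    have hρout' : outputDescription ρ' = outputDescription ρ := by
      simp [outputDescription, hρn', hρr']
    simp only [← hρn', ← hρr' 8 (by norm_num), ← hρr' 12 (by norm_num), ← hρr' 13 (by norm_num),
      ← hρr' 3 (by norm_num)] at h8 hj hB hje hρ12 hρ13 hρ14 I he hX ⊢
    rw [← hρout'] at I
    rcases le_or_gt (ρ'.real 14 0) 1 with hV | hV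
    · rw [Prog.exec, if_pos (by simpa [Test.eval, NatExp.eval, RealExp.eval, realVar] using hV)]
      exact crossSlope_inv C H hc hρσ' h8 I hj hB hρ12 hρ13 hX he hρ14 hV
    · rw [Prog.exec, if_neg (by simpa [Test.eval, NatExp.eval, RealExp.eval, realVar] using hV)]
      have hb := H.b_succ C hj
      have hlate : b (h (ρ'.nat 6 0 + 1)) < flow b h τ (ρ'.nat 6 0) (ρ'.real 12 0)
          (ρ'.real 13 0) (ρ'.real 3 (ρ'.nat 1 0)) (τ (ρ'.nat 7 0)) := by
        rw [← hρ14]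
        nlinarith
      refine crossEdge_inv C H hc hρσ' h8 I hj hB hρ12 hρ13 (lt_of_le_of_ne hX ?_)
        fun _ => hlate
      -- if the speed were zero, then the position would not change
      intro h0
      have h1 := flow_start C H hj (ρ'.real 12 0) (ρ'.real 8 0) (ρ'.real 3 (ρ'.nat 1 0))
      rw [hρ12, ← hρ13, ← h0] at h1
      rw [hρ12, ← h0] at hlate
      simp only [flow, zero_mul] at h1 hlate
      linarith
  · have he' : ρ.nat 7 0 = m := le_antisymm I.e_le he
    rw [Prog.exec, if_pos (by simpa [Test.eval, NatExp.eval, natVar, hρσ.nat_five] using he)]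
    rcases hX.eq_or_lt with hX0 | hX0
    · rw [Prog.exec, if_pos (by simp [Test.eval, NatExp.eval, RealExp.eval, realVar, ← hX0])]
      refine ⟨0, hje, Or.inr ⟨rfl, Or.inl ⟨?_, ?_⟩⟩⟩
      · simp [stationaryPiece, Prog.exec, NatExp.eval, Store.nat_setNat]
      · have hout : outputDescription (stationaryPiece.exec ρ) =
            outputDescription (flowPiece.exec ρ) := rfl
        rw [hout, flowPiece_output, hρσ.nat_four, hρ12, he']
        rw [he'] at I hρ13
        exact I.finish_stationary C H hc hj hB hρ13 hX0.symm _ _ _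
    · rw [Prog.exec, if_neg (by simpa [Test.eval, NatExp.eval, RealExp.eval, realVar] using hX0)]
      exact crossEdge_inv C H hc hρσ h8 I hj hB hρ12 hρ13 hX0 fun h1 => absurd he (not_le.2 h1)

/-- An upper bound for the number of steps of the construction of a strategy. -/
def pathCost (m : ℕ) : ℕ := pathInit.maxCost + ((2 * m + 1) * (4 + pathBody.maxCost) + 4)

theorem path_achieves (C : Costs k b r) (H : IsHull k b r m h τ) (hm : 0 < m) (hc : 1 ≤ c)
    (hσ : HasHull b r ε m h τ σ) (h9 : σ.real 9 0 = c) :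
    Achieves path σ (pathCost m) fun ρ => HasHull b r ε m h τ ρ ∧
      (∀ a, 9 ≤ a ∧ a < 12 → ρ.real a = σ.real a) ∧ PathResult k b r m h τ c ρ := by
  let J : ℕ → Store → Prop := fun v ρ => (HasHull b r ε m h τ ρ ∧
    ∀ a, 9 ≤ a ∧ a < 12 → ρ.real a = σ.real a) ∧ PathLoopInv k b r m h τ c v ρ
  have hinit : Achieves pathInit σ pathInit.maxCost fun ρ => J (2 * m + 1) ρ := by
    refine pathInit_loopFree.achieves ⟨⟨hσ.exec_pathInit, ?_⟩, Or.inl ⟨?_, ?_, ?_⟩⟩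
    · intro a ha
      refine Prog.exec_real ?_ σ
      simp only [pathInit, Prog.SetsReal, or_false, false_or]
      omega
    · simp [pathInit, Prog.exec, NatExp.eval, Store.nat_setNat]
    · simp [pathInit, Prog.exec, NatExp.eval, Store.nat_setNat]
    · have h1 := PathInv.init (D := outputDescription (pathInit.exec σ)) C H hc
        (by simp [pathInit, Prog.exec, NatExp.eval, Store.nat_setNat, Store.nat_setReal,
              outputDescription])
        (by simp [pathInit, Prog.exec, NatExp.eval, RealExp.eval, Store.real_setNat,
              Store.real_setReal, outputDescription])
      have e1 : (pathInit.exec σ).real 8 0 = c * b 0 := by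
        simp [pathInit, Prog.exec, NatExp.eval, RealExp.eval, realVar, Store.real_setNat,
          Store.real_setReal, h9, hσ.real_zero]
      have e2 : (pathInit.exec σ).nat 6 0 = 0 := by
        simp [pathInit, Prog.exec, NatExp.eval, Store.nat_setNat]
      have e3 : (pathInit.exec σ).nat 7 0 = 0 := by
        simp [pathInit, Prog.exec, NatExp.eval, Store.nat_setNat]
      rw [e1, e2, e3]
      exact h1
  have hbody : ∀ v ρ, J v ρ → (Test.natLe (natVar 8) (.lit 0)).eval ρ →
      Achieves pathBody ρ pathBody.maxCost fun ρ' => ∃ w, w < v ∧ J w ρ' := by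
    rintro v ρ ⟨⟨hρ, hρr⟩, hρJ⟩ hs
    apply pathBody_loopFree.achieves
    have h8 : ρ.nat 8 0 = 0 := by
      simpa [Test.eval, NatExp.eval, natVar] using hs
    have hrun : ρ.nat 8 0 = 0 ∧ v = 2 * m + 1 - ρ.nat 6 0 - ρ.nat 7 0 ∧
        PathInv k b r m h τ c (outputDescription ρ) (ρ.real 8 0) (ρ.nat 6 0) (ρ.nat 7 0) := by
      rcases hρJ with h1 | ⟨-, ⟨h1, -⟩ | ⟨h1, -⟩⟩
      · exact h1
      · omega
      · omega
    obtain ⟨-, rfl, I⟩ := hrun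
    obtain ⟨w, hw, hw'⟩ := pathBody_inv C H hm hc hρ ((hρr 9 (by norm_num)).symm ▸ h9) h8 I
    refine ⟨w, hw, ⟨hρ.exec_pathBody, fun a ha => ?_⟩, hw'⟩
    rw [Prog.exec_real (pathBody_sets_real (Or.inr (Or.inr ha))), hρr a ha]
  refine hinit.seq fun ρ hρ => (Achieves.loop hbody _ ρ hρ).mono le_rfl ?_
  rintro ρ' ⟨⟨w, ⟨h1, h2⟩, h3⟩, hs⟩
  refine ⟨h1, h2, ?_⟩
  rcases h3 with ⟨h4, -⟩ | ⟨-, h4⟩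
  · exact absurd (by simpa [Test.eval, NatExp.eval, natVar] using h4) hs
  · exact h4

end

end SkiRental

/-! ### The bisection for the competitive ratio -/

namespace SkiRental

open RealRAM

section
variable {k m : ℕ} {h : ℕ → ℕ} {τ : ℕ → ℝ} {ε c : ℝ} {σ : Store} {M : Instance k}

/-- A sufficient condition for the success of the construction of a `c`-competitive strategy. -/
def Feasible (k : ℕ) (b r : ℕ → ℝ) (m : ℕ) (h : ℕ → ℕ) (τ : ℕ → ℝ) (c : ℝ) : Prop :=
  2 ≤ c ∨ ∃ R S, Competitor k b r m h τ c R S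

theorem PathResult.solves {b r : ℕ → ℝ} (hσ : PathResult k b r m h τ c σ)
    (hc : Feasible k b r m h τ c) : Solves k b r m h τ c (outputDescription σ) := by
  rcases hσ with ⟨-, hS⟩ | ⟨-, h2, hno⟩
  · exact hS
  · rcases hc with h3 | ⟨R, S, hRS⟩
    · linarith
    · exact absurd hRS (hno R S)

theorem Solves.feasible {D : Description} (H : IsHull k M.bSeq M.rSeq m h τ) (hc : 1 ≤ c)
    (S : Solves k M.bSeq M.rSeq m h τ c D) : Feasible k M.bSeq M.rSeq m h τ c :=
  Or.inr ⟨_, _, (S.isCompetitive H).competitor (S.isProfile M.costs H).isStrategy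
    (zero_le_one.trans hc) H⟩

/-- The bounds `lo` and `hi` of the bisection. -/
structure HasBounds (M : Instance k) (m : ℕ) (h : ℕ → ℕ) (τ : ℕ → ℝ) (lo hi : ℝ)
    (σ : Store) : Prop where
  lo_eq : σ.real 10 0 = lo
  hi_eq : σ.real 11 0 = hi
  one_le_lo : 1 ≤ lo
  one_le_hi : 1 ≤ hi
  lo_mem : lo ∈ lowerBounds M.achievable
  feasible : Feasible k M.bSeq M.rSeq m h τ hi

/-- An upper bound for the number of steps of one step of the bisection. -/
def bisectBodyCost (m : ℕ) : ℕ := 9 + (pathCost m + 8)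

theorem bisectBody_achieves (H : IsHull k M.bSeq M.rSeq m h τ) (hm : 0 < m)
    (hσ : HasHull M.bSeq M.rSeq ε m h τ σ) {lo hi : ℝ} (hb : HasBounds M m h τ lo hi σ) :
    Achieves bisectBody σ (bisectBodyCost m) fun ρ => HasHull M.bSeq M.rSeq ε m h τ ρ ∧
      ∃ lo' hi', hi' - lo' = (hi - lo) / 2 ∧ HasBounds M m h τ lo' hi' ρ := by
  have hset : Achieves (.setReal 9 (.lit 0) (.div (.add (realVar 10) (realVar 11)) (.lit 2))) σ 9
      fun ρ => ρ = σ.setReal 9 0 ((lo + hi) / 2) := by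
    refine Prog.LoopFree.achieves
      (P := .setReal 9 (.lit 0) (.div (.add (realVar 10) (realVar 11)) (.lit 2))) trivial ?_
    simp [Prog.exec, RealExp.eval, NatExp.eval, realVar, hb.lo_eq, hb.hi_eq]
  have hc : 1 ≤ (lo + hi) / 2 := by linarith [hb.one_le_lo, hb.one_le_hi]
  refine hset.seq ?_
  rintro _ rfl
  have hσ' : HasHull M.bSeq M.rSeq ε m h τ (σ.setReal 9 0 ((lo + hi) / 2)) :=
    ⟨hσ.1, hσ.2, hσ.3, hσ.4, hσ.5, hσ.6⟩
  refine (path_achieves M.costs H hm hc hσ' (by simp [Store.real_setReal])).seq ?_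
  rintro ρ ⟨hρ, hρr, hres⟩
  have h9 : ρ.real 9 0 = (lo + hi) / 2 := by
    rw [hρr 9 (by norm_num)]; simp [Store.real_setReal]
  have h10 : ρ.real 10 0 = lo := by
    rw [hρr 10 (by norm_num)]; simpa [Store.real_setReal] using hb.lo_eq
  have h11 : ρ.real 11 0 = hi := by
    rw [hρr 11 (by norm_num)]; simpa [Store.real_setReal] using hb.hi_eq
  refine (Prog.LoopFree.achieves (P := .cond (.natLe (natVar 8) (.lit 1))
    (.setReal 11 (.lit 0) (realVar 9)) (.setReal 10 (.lit 0) (realVar 9))) ⟨trivial, trivial⟩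
    ?_).mono (K := 8) le_rfl fun _ hx => hx
  rcases hres with ⟨h8, hS⟩ | ⟨h8, -, hno⟩
  · rw [Prog.exec, if_pos (by simp [Test.eval, NatExp.eval, natVar, h8])]
    refine ⟨⟨hρ.1, hρ.2, hρ.3, hρ.4, hρ.5, hρ.6⟩, lo, (lo + hi) / 2, by ring, ?_⟩
    refine ⟨?_, ?_, hb.one_le_lo, hc, hb.lo_mem, hS.feasible H hc⟩
    · simpa [Prog.exec, Store.real_setReal] using h10
    · simpa [Prog.exec, RealExp.eval, NatExp.eval, realVar, Store.real_setReal] using h9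
  · rw [Prog.exec, if_neg (by simp [Test.eval, NatExp.eval, natVar, h8])]
    refine ⟨⟨hρ.1, hρ.2, hρ.3, hρ.4, hρ.5, hρ.6⟩, (lo + hi) / 2, hi, by ring, ?_⟩
    refine ⟨?_, ?_, hc, hb.one_le_hi, M.le_of_no_competitor H (by linarith) hno, hb.feasible⟩
    · simpa [Prog.exec, RealExp.eval, NatExp.eval, realVar, Store.real_setReal] using h9
    · simpa [Prog.exec, Store.real_setReal] using h11

/-- The bisection takes `v` steps if `2 ^ v` times the precision is the length of the initial
interval. -/
theorem bisect_achieves (hk : 1 ≤ k) (H : IsHull k M.bSeq M.rSeq m h τ)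
    (hσ : HasHull M.bSeq M.rSeq ε m h τ σ) {v : ℕ} (hv : 1 ≤ 2 ^ v * ε) :
    Achieves bisect σ (8 + (v * (9 + bisectBodyCost m) + 9)) fun ρ =>
      HasHull M.bSeq M.rSeq ε m h τ ρ ∧
        ∃ lo hi, hi ≤ lo + ε ∧ HasBounds M m h τ lo hi ρ := by
  have hm := H.pos hk
  let J : ℕ → Store → Prop := fun v ρ => HasHull M.bSeq M.rSeq ε m h τ ρ ∧
    ∃ lo hi, hi - lo ≤ 2 ^ v * ε ∧ HasBounds M m h τ lo hi ρ
  have hinit : Achieves bisectInit σ 8 fun ρ => J v ρ := by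
    refine (Prog.LoopFree.achieves (P := bisectInit) ⟨trivial, trivial⟩ ?_).mono (K := 6)
      (by norm_num) fun _ hx => hx
    refine ⟨⟨hσ.1, hσ.2, hσ.3, hσ.4, hσ.5, hσ.6⟩, 1, 2, by linarith, ?_, ?_, le_rfl,
      one_le_two, M.one_mem_lowerBounds hk H, Or.inl le_rfl⟩
    · simp [bisectInit, Prog.exec, RealExp.eval, NatExp.eval, Store.real_setReal]
    · simp [bisectInit, Prog.exec, RealExp.eval, NatExp.eval, Store.real_setReal]
  have hbody : ∀ v ρ, J v ρ →
      (Test.not (.realLe (realVar 11) (.add (realVar 10) (realVar 2)))).eval ρ →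
      Achieves bisectBody ρ (bisectBodyCost m) fun ρ' => ∃ w, w < v ∧ J w ρ' := by
    rintro v ρ ⟨hρ, lo, hi, hle, hb⟩ hs
    have hgap : lo + ε < hi := by
      simpa [Test.eval, RealExp.eval, NatExp.eval, realVar, hb.lo_eq, hb.hi_eq, hρ.real_two]
        using hs
    refine (bisectBody_achieves H hm hρ hb).mono le_rfl ?_
    rintro ρ' ⟨hρ', lo', hi', heq, hb'⟩
    rcases v with _ | v
    · rw [pow_zero, one_mul] at hle
      linarith
    · refine ⟨v, Nat.lt_succ_self v, hρ', lo', hi', ?_, hb'⟩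
      rw [heq, div_le_iff₀ two_pos]
      rw [pow_succ] at hle
      linarith
  refine hinit.seq fun ρ hρ => (Achieves.loop hbody _ ρ hρ).mono le_rfl ?_
  rintro ρ' ⟨⟨w, hρ', lo, hi, -, hb⟩, hs⟩
  refine ⟨hρ', lo, hi, ?_, hb⟩
  simpa [Test.eval, RealExp.eval, NatExp.eval, realVar, hb.lo_eq, hb.hi_eq, hρ'.real_two] using hs

/-- An upper bound for the number of steps of the program that takes `v` steps of the bisection. -/
def progCost (k m v : ℕ) : ℕ :=
  3 + (2 * k * (3 + 2 + scanBody.maxCost) + 5) +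
    (8 + (v * (9 + bisectBodyCost m) + 9) + (4 + pathCost m))

theorem hasInput_inputStore (M : Instance k) (ε : ℝ) :
    HasInput k M.bSeq M.rSeq ε (inputStore M ε) where
  nat_zero := rfl
  real_zero := rfl
  real_one := rfl
  real_two := rfl

theorem skiRentalProg_achieves (hk : 1 ≤ k) (M : Instance k) {v : ℕ} (hv : 1 ≤ 2 ^ v * ε) :
    ∃ m h τ, IsHull k M.bSeq M.rSeq m h τ ∧
      Achieves skiRentalProg (inputStore M ε) (progCost k m v) fun ρ =>
        ∃ lo hi, hi ≤ lo + ε ∧ lo ∈ lowerBounds M.achievable ∧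
          Solves k M.bSeq M.rSeq m h τ hi (outputDescription ρ) := by
  obtain ⟨n, σ, hrun, hn, m, h, τ, H, hσ⟩ :=
    scan_achieves M.costs hk (hasInput_inputStore M ε) rfl rfl
  refine ⟨m, h, τ, H, Achieves.seq (Q := fun ρ => HasHull M.bSeq M.rSeq ε m h τ ρ)
    ⟨n, σ, hrun, hn, hσ⟩ fun σ hσ => (bisect_achieves hk H hσ hv).seq ?_⟩
  rintro ρ ⟨hρ, lo, hi, hle, hb⟩
  have hset : Achieves (.setReal 9 (.lit 0) (realVar 11)) ρ 4 fun ρ' => ρ' = ρ.setReal 9 0 hi := by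
    refine Prog.LoopFree.achieves (P := .setReal 9 (.lit 0) (realVar 11)) trivial ?_
    simp [Prog.exec, RealExp.eval, NatExp.eval, realVar, hb.hi_eq]
  refine hset.seq ?_
  rintro _ rfl
  have hρ' : HasHull M.bSeq M.rSeq ε m h τ (ρ.setReal 9 0 hi) :=
    ⟨hρ.1, hρ.2, hρ.3, hρ.4, hρ.5, hρ.6⟩
  refine (path_achieves M.costs H (H.pos hk) hb.one_le_hi hρ'
    (by simp [Store.real_setReal])).mono le_rfl ?_
  rintro ρ' ⟨-, -, hres⟩
  exact ⟨lo, hi, hle, hb.lo_mem, hres.solves hb.feasible⟩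

/-- The constant of the linear bound for the running time. -/
def costFactor : ℕ :=
  2 * (5 + scanBody.maxCost) + 2 * (pathInit.maxCost + 3 * (4 + pathBody.maxCost) + 4) + 54

theorem progCost_le (hk : 1 ≤ k) (hmk : m ≤ k) (v : ℕ) :
    progCost k m v ≤ costFactor * (k * (v + 1)) := by
  have h1 : pathCost m ≤ (pathInit.maxCost + 3 * (4 + pathBody.maxCost) + 4) * k := by
    have h2 : (2 * m + 1) * (4 + pathBody.maxCost) ≤ (3 * k) * (4 + pathBody.maxCost) :=
      Nat.mul_le_mul_right _ (by omega)
    unfold pathCost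
    nlinarith
  unfold progCost costFactor bisectBodyCost
  generalize pathInit.maxCost + 3 * (4 + pathBody.maxCost) + 4 = p at *
  generalize scanBody.maxCost = s
  have h2 : v * pathCost m ≤ v * (p * k) := Nat.mul_le_mul_left _ h1
  have h3 : v ≤ k * v := Nat.le_mul_of_pos_left v hk
  nlinarith [Nat.zero_le (s * (k * v)), Nat.zero_le (p * (k * v))]

end

end SkiRental

end

theorem mainTheorem3 :
    ∃ (P : RealRAM.Prog) (C : ℝ),
      ∀ (k : ℕ), 1 ≤ k → ∀ (M : SkiRental.Instance k) (c : ℝ), IsGLB M.achievable c →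
        ∀ ε : ℝ, 0 < ε → ε ≤ 1 / 2 →
          ∃ (n : ℕ) (σ : RealRAM.Store),
            RealRAM.Runs P (SkiRental.inputStore M ε) n σ ∧
            (n : ℝ) ≤ C * (k * Real.log (1 / ε)) ∧
            (SkiRental.outputDescription σ).WellFormed k ∧
            SkiRental.IsStrategy
              (SkiRental.strategyOf ((SkiRental.outputDescription σ).profile k)) ∧
            (∀ t : ℝ, 0 ≤ t →
              SkiRental.profileOf
                (SkiRental.strategyOf ((SkiRental.outputDescription σ).profile k)) t =
                  (SkiRental.outputDescription σ).profile k t) ∧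
            SkiRental.IsCompetitive M
              (SkiRental.strategyOf ((SkiRental.outputDescription σ).profile k)) (c + ε) := by
  refine ⟨SkiRental.skiRentalProg, SkiRental.costFactor * (3 / Real.log 2), ?_⟩
  intro k hk M c hc ε hε hε2
  have hlog2 : 0 < Real.log 2 := Real.log_pos one_lt_two
  have hlog : Real.log 2 ≤ Real.log (1 / ε) :=
    Real.log_le_log two_pos ((le_div_iff₀ hε).2 (by linarith))
  set v := ⌈Real.log (1 / ε) / Real.log 2⌉₊ with hv
  have hv1 : Real.log (1 / ε) / Real.log 2 ≤ v := Nat.le_ceil _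
  have hv2 : (v : ℝ) < Real.log (1 / ε) / Real.log 2 + 1 :=
    Nat.ceil_lt_add_one (div_nonneg (hlog2.le.trans hlog) hlog2.le)
  have hpow : 1 ≤ 2 ^ v * ε := by
    rw [← div_le_iff₀ hε]
    rw [div_le_iff₀ hlog2, ← Real.log_pow] at hv1
    exact (Real.log_le_log_iff (by positivity) (by positivity)).1 hv1
  obtain ⟨m, h, τ, H, n, σ, hrun, hn, lo, hi, hle, hlo, hS⟩ :=
    SkiRental.skiRentalProg_achieves hk M hpow
  have hprof := hS.isProfile M.costs H
  refine ⟨n, σ, hrun, ?_, hS.wellFormed H, hprof.isStrategy,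
    fun t ht => hprof.profileOf_strategyOf ht, (hS.isCompetitive H).mono ?_⟩
  · have hmk : m ≤ k := (H.le_index le_rfl).trans_eq H.last
    have h1 : (n : ℝ) ≤ SkiRental.costFactor * (k * (v + 1)) := by
      exact_mod_cast hn.trans (SkiRental.progCost_le hk hmk v)
    have h2 : (v : ℝ) + 1 ≤ 3 / Real.log 2 * Real.log (1 / ε) := by
      have h3 : 1 ≤ Real.log (1 / ε) / Real.log 2 := (one_le_div hlog2).2 hlog
      have h4 : 3 / Real.log 2 * Real.log (1 / ε) = 3 * (Real.log (1 / ε) / Real.log 2) := by ring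
      linarith
    calc (n : ℝ) ≤ SkiRental.costFactor * (k * (v + 1)) := h1
      _ ≤ SkiRental.costFactor * (k * (3 / Real.log 2 * Real.log (1 / ε))) := by gcongr
      _ = _ := by ring
  · have := hc.2 hlo
    linarith
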